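/- Let $d,n\ge 1$ be integers. Functions on the torus $\mathbb T^d=\mathbb R^d/\mathbb Z^d$ are identified with $\mathbb Z^d$-periodic functions on $\mathbb R^d$. For $v\in\mathbb R^d$ put $\partial_v f(\theta)=\frac{d}{dt}f(\theta+tv)|_{t=0}$. For matrices, $\|\cdot\|$ is the operator norm induced by the Euclidean norm, $\bar A$ is the entrywise complex conjugate of $A$, and for matrix-valued $f$ of class $\mathcal C^r$ on $\mathbb T^d$, $\|f\|_{\mathcal C^r}=\max_{|\alpha|\le r}\sup_\theta\|\partial^\alpha f(\theta)\|$. A vector $\omega\in\mathbb R^d$ is in $\mathcal{DC}(\kappa,\tau)$, where $\kappa>0$ and $\tau>d-1$, if $|\langle k,\omega\rangle|\ge \kappa/|k|^\tau$ for all $k\in\mathbb Z^d\setminus\{0\}$, where $|k|=\sum_i|k_i|$. There is a constant $C_1>0$ depending only on $n$ and $d$ with the following property. Let $\omega\in\mathcal{DC}(\kappa,\tau)$, $N\in\mathbb N$, $\rho>0$. Let $U:\mathbb T^d\to Gl(n,\mathbb C)$ be of class $\mathcal C^{d+1}$ with $U(\theta)^{-1}=\overline{U(\theta)}$ for all $\theta$,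 let $B\in gl(n,\mathbb C)$ be in Jordan normal form, and suppose that $$G=\partial_\omega U-BU+U\bar B$$ is of class $\mathcal C^{d+1}$. Assume that 1. $C_1\|U\|_{\mathcal C^{d+1}}\|U\|_{\mathcal C^0}\le N$, 2. $\|G\|_{\mathcal C^{d+1}}\le C_1^{-1}\rho^{2n-1}N^{-(d-1)}\|U\|_{\mathcal C^0}^{-n}$, 3. $\rho\le C_1^{-1}\min\left(\dfrac{1}{N^d\|U\|_{\mathcal C^0}^{n+1}},\dfrac{\kappa}{N^\tau}\right)$. Then there are $W\in\mathcal C^\infty(\mathbb T^d,Gl(n,\mathbb C))$, a real matrix $B'\in gl(n,\mathbb R)$ and $B''\in gl(n,\mathbb C)$ such that $$\partial_{\frac{\omega}{2}}W=BW-W(B'+B''),\qquad \|B''\|\le 2n^2\rho,\qquad \|B'\|\le C_1\|B\|,$$ $$\|W\|_{\mathcal C^s}\le(2\pi nN)^{2s}\quad\text{and}\quad\|W^{-1}\|_{\mathcal C^s}\le(2\pi nN)^{2s}\qquad\text{for all } s\in\mathbb N.$$ Moreover, there is a unitary matrix $P$ such that $PB'P^*$ has the diagonal block structure of $B$ (its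 $(i,j)$ entry vanishes whenever $B_{ii}\ne B_{jj}$) and such that, for every $\theta$, $W(\theta)P^*$ commutes with $B$, $PB'P^*$ and $PB''P^*$. -/

import Mathlib

open scoped Matrix.Norms.L2Operator

namespace QPCocycle

/-- A function on the torus `ℝ^d / ℤ^d` is a function on `ℝ^d` invariant under
translations by vectors of `ℤ^d`. -/
def IsTorusFun {d : ℕ} {E : Type*} (f : (Fin d → ℝ) → E) : Prop :=
  ∀ (θ : Fin d → ℝ) (k : Fin d → ℤ), f (θ + fun i => (k i : ℝ)) = f θ

/-- The Diophantine condition `DC(κ, τ)`, where `|k|` is the `ℓ¹` norm of `k`. -/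
def IsDiophantine {d : ℕ} (ω : Fin d → ℝ) (κ τ : ℝ) : Prop :=
  0 < κ ∧ (d : ℝ) - 1 < τ ∧
    ∀ k : Fin d → ℤ, k ≠ 0 →
      κ / (∑ i, |(k i : ℝ)|) ^ τ ≤ |∑ i, (k i : ℝ) * ω i|

section CNorm

variable {d : ℕ} {E : Type*} [NormedAddCommGroup E] [NormedSpace ℝ E]

/-- The derivative along `ω`, that is `d/dt f(θ + t ω)` at `t = 0`. -/
noncomputable def dirDeriv (ω : Fin d → ℝ) (f : (Fin d → ℝ) → E) : (Fin d → ℝ) → E :=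
  fun θ => lineDeriv ℝ f θ ω

/-- The partial derivative `∂^α` for a multi-index `α`: the partial derivative in the
`i`-th variable is taken `α i` times, for every `i`. -/
noncomputable def multiDeriv (α : Fin d → ℕ) (f : (Fin d → ℝ) → E) : (Fin d → ℝ) → E :=
  (List.finRange d).foldr (fun i g => (dirDeriv (Pi.single i (1 : ℝ)))^[α i] g) f

/-- The `C^r` norm: the maximum over `|α| ≤ r` of the sup norms of `∂^α f`. It is used only
for functions on the torus of class `C^r`, for which all these suprema are finite. -/
noncomputable def cNorm (r : ℕ) (f : (Fin d → ℝ) → E) : ℝ :=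
  ⨆ α : {α : Fin d → ℕ // ∑ i, α i ≤ r}, ⨆ θ : Fin d → ℝ, ‖multiDeriv α.1 f θ‖

end CNorm

/-- Entrywise complex conjugate of a matrix. -/
def conjMat {n : ℕ} (A : Matrix (Fin n) (Fin n) ℂ) : Matrix (Fin n) (Fin n) ℂ :=
  A.map (starRingEnd ℂ)

/-- A matrix in Jordan normal form: all off-diagonal entries vanish, except that an entry
just above the diagonal may be `1` when the two neighbouring diagonal entries are equal. -/
def IsJordanForm {n : ℕ} (B : Matrix (Fin n) (Fin n) ℂ) : Prop :=
  ∀ i j : Fin n, i ≠ j →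
    B i j = 0 ∨ ((j : ℕ) = (i : ℕ) + 1 ∧ B i j = 1 ∧ B i i = B j j)

/-- The complex matrix with the entries of a real matrix. -/
def toComplexMat {n : ℕ} (A : Matrix (Fin n) (Fin n) ℝ) : Matrix (Fin n) (Fin n) ℂ :=
  A.map Complex.ofReal

end QPCocycle

namespace QPCocycle

/-! ### Chains of consecutive integers -/

section Chains

variable (lk : ℕ → Prop)

/-! The defect equation says that `U` almost intertwines `B` with its conjugate, and the existence
of `W` is extracted from the values of a truncated `U` at a single point of the torus. In Fourier
modes the equation is a Sylvester equation whose `(i, j)` entry has divisor `B i i - conj (B j j) -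
2πi⟨k, ω⟩`. Hence a coefficient of `U` is small unless the divisor is at most `ρ`
(`norm_sylvester_le'`) or `k` is large, in which case the first derivatives of `U` control it. By
Parseval, keeping only the almost resonant modes changes `U` little in mean square, and what remains
almost commutes with the nilpotent part of `B`. A mean is attained or undercut somewhere, so at one
`θ` all these quantities are small together: `exists_approximate_intertwiner` gives a matrix `V`
there, close to `U θ`, whose approximate inverse is `conjMat (U θ)`.

The rest is linear algebra. Join an eigenvalue to each conjugate eigenvalue that is close to it
modulo a frequency of size at most `N`. The matrix `V` only connects a component of this graph to
the conjugate component. Since it is almost invertible and almost commutes with the nilpotent part,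
conjugate components contain equally many indices of each depth in their Jordan chains
(`card_depth_le`), hence equally many Jordan blocks of each length. Blocks can therefore be paired
by an involution `σ` (`exists_chain_involution`), and simple paths in the graph give `B i i ≈ conj
(B (σ i) (σ i)) + 2πi⟨m i, ω⟩` with `|m i| ≤ 2nN` and error `2nρ` (`exists_involution_and_shift`).

Finally `W` is explicit (`exists_conjugation`): `W θ = D θ * P`, with `D` the diagonal matrix of the
characters of frequencies `m i` and `P` a unitary square root of the permutation matrix of `σ`.
Differentiating `D` along `ω / 2` removes half of each frequency from `B`. What is left is a matrix
invariant under conjugation combined with `σ`, which `P` turns into the real `B'`, plus a diagonal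
error, which becomes `B''`. -/

open Classical in
/-- The number of consecutive links ending at a given integer. -/
noncomputable def chainDepth : ℕ → ℕ
  | 0 => 0
  | a + 1 => if lk a then chainDepth a + 1 else 0

lemma chainDepth_succ_of_link {a : ℕ} (h : lk a) :
    chainDepth lk (a + 1) = chainDepth lk a + 1 := by
  simp [chainDepth, h]

lemma chainDepth_succ_of_not_link {a : ℕ} (h : ¬ lk a) : chainDepth lk (a + 1) = 0 := by
  simp [chainDepth, h]

lemma chainDepth_le (a : ℕ) : chainDepth lk a ≤ a := by
  induction a with
  | zero => simp [chainDepth]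
  | succ a ih =>
    by_cases h : lk a
    · rw [chainDepth_succ_of_link lk h]; omega
    · rw [chainDepth_succ_of_not_link lk h]; omega

lemma link_of_chainDepth_pos {a : ℕ} (h : 0 < chainDepth lk a) :
    ∃ b, a = b + 1 ∧ lk b := by
  cases a with
  | zero => simp [chainDepth] at h
  | succ b =>
    refine ⟨b, rfl, ?_⟩
    by_contra hb
    rw [chainDepth_succ_of_not_link lk hb] at h
    omega

variable {lk} {n : ℕ} (hlk : ∀ a, lk a → a + 1 < n)

/-- The number of consecutive links starting at a given integer. -/
noncomputable def chainHeight (lk : ℕ → Prop) (a : ℕ) : ℕ := sInf {h | ¬ lk (a + h)}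

include hlk in
lemma chainHeight_spec (a : ℕ) : ¬ lk (a + chainHeight lk a) := by
  have : Set.Nonempty {h | ¬ lk (a + h)} := ⟨n, fun h => by have := hlk _ h; omega⟩
  exact Nat.sInf_mem this

lemma chainHeight_eq_zero {a : ℕ} (h : ¬ lk a) : chainHeight lk a = 0 := by
  unfold chainHeight
  rw [Nat.sInf_eq_zero]
  exact Or.inl h

include hlk in
lemma chainHeight_of_link {a : ℕ} (h : lk a) :
    chainHeight lk a = chainHeight lk (a + 1) + 1 := by
  have h1 : Set.Nonempty {h | ¬ lk (a + h)} := ⟨n, fun h => by have := hlk _ h; omega⟩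
  have h2 := Nat.sInf_mem h1
  have hpos : chainHeight lk a ≠ 0 := by
    intro h0
    have := chainHeight_spec hlk a
    rw [h0] at this
    exact this h
  obtain ⟨m, hm⟩ := Nat.exists_eq_succ_of_ne_zero hpos
  apply le_antisymm
  · apply Nat.sInf_le
    have := chainHeight_spec hlk (a + 1)
    rw [show a + 1 + chainHeight lk (a + 1) = a + (chainHeight lk (a + 1) + 1) by ring] at this
    exact this
  · rw [hm]
    refine Nat.succ_le_succ (Nat.sInf_le ?_)
    have := chainHeight_spec hlk a
    rw [hm, show a + m.succ = a + 1 + m by omega] at this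
    exact this

/-- Positive depth forces a link from the predecessor, so one can descend `chainDepth lk e` times
without leaving the chain of `e`. -/
lemma chain_down {e : ℕ} : ∀ h ≤ chainDepth lk e,
    chainDepth lk (e - h) = chainDepth lk e - h ∧ ∀ j < h, lk (e - h + j) := by
  intro h
  induction h with
  | zero => intro _; simp
  | succ h ih =>
    intro hh
    obtain ⟨h1, h2⟩ := ih (by omega)
    obtain ⟨b, hb, hlb⟩ := link_of_chainDepth_pos lk (a := e - h) (by omega)
    have hb' : e - (h + 1) = b := by omega
    rw [hb, chainDepth_succ_of_link lk hlb] at h1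
    rw [hb']
    refine ⟨by omega, fun j hj => ?_⟩
    rcases j with _ | j
    · exact hlb
    · have := h2 j (by omega)
      rw [hb] at this
      rwa [show b + (j + 1) = b + 1 + j by ring]

include hlk in
lemma chainHeight_sub {e h : ℕ} (he : ¬ lk e) (hh : h ≤ chainDepth lk e) :
    chainHeight lk (e - h) = h := by
  have hle := chainDepth_le lk e
  induction h with
  | zero => simpa using chainHeight_eq_zero he
  | succ h ih =>
    have h2 := (chain_down (h + 1) hh).2 0 (by omega)
    rw [add_zero] at h2
    rw [chainHeight_of_link hlk h2, show e - (h + 1) + 1 = e - h by omega, ih (by omega)]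

lemma chainDepth_add (a : ℕ) : ∀ j, (∀ i < j, lk (a + i)) →
    chainDepth lk (a + j) = chainDepth lk a + j := by
  intro j
  induction j with
  | zero => simp
  | succ j ih =>
    intro h
    rw [← add_assoc, chainDepth_succ_of_link lk (h j (by omega)), ih fun i hi => h i (by omega)]
    ring

lemma link_of_lt_chainHeight {a i : ℕ} (h : i < chainHeight lk a) : lk (a + i) := by
  by_contra hc
  exact absurd (Nat.sInf_le (s := {h | ¬ lk (a + h)}) hc) (not_le.mpr h)

/-- If a key function has fibres matched in cardinality by an involution of the keys, then the
involution lifts to an involution of the domain. -/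
lemma exists_involution_of_card_fiber {T K : Type*} [Fintype T] [DecidableEq K] (key : T → K)
    (st : K → K) (hst : Function.Involutive st)
    (hcard : ∀ κ, Fintype.card {t // key t = κ} = Fintype.card {t // key t = st κ}) :
    ∃ σ : T → T, Function.Involutive σ ∧ ∀ t, key (σ t) = st (key t) := by
  classical
  -- Number the elements of every fibre; the partner of `t` carries the same number in the opposite
  -- fibre. Elements of a fibre fixed by `st` are then their own partners.
  let e : ∀ κ, {t // key t = κ} ≃ Fin (Fintype.card {t // key t = κ}) :=
    fun κ => Fintype.equivFin _
  let idx : T → ℕ := fun t => e (key t) ⟨t, rfl⟩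
  have hidx : ∀ κ (t : {t // key t = κ}), idx t.1 = (e κ t : ℕ) := by
    rintro κ ⟨t, rfl⟩
    rfl
  have huniq : ∀ t t', key t = key t' → idx t = idx t' → t = t' := by
    intro t t' h1 h2
    rw [hidx (key t') ⟨t, h1⟩, hidx (key t') ⟨t', rfl⟩] at h2
    have := (e (key t')).injective (Fin.ext h2)
    exact congrArg Subtype.val this
  have hex : ∀ t, ∃ t', key t' = st (key t) ∧ idx t' = idx t := by
    intro t
    have hlt : idx t < Fintype.card {s // key s = st (key t)} := by
      rw [← hcard]
      exact (e (key t) ⟨t, rfl⟩).2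
    let s := (e (st (key t))).symm ⟨idx t, hlt⟩
    refine ⟨s.1, s.2, ?_⟩
    rw [hidx _ s]
    simp [s]
  choose σ h1 h2 using hex
  refine ⟨σ, fun t => huniq _ _ ?_ ?_, h1⟩
  · rw [h1, h1, hst]
  · rw [h2, h2]

include hlk in
/-- If the numbers of elements of depth at least `j` are matched by an involution of the keys,
then there is an involution compatible with keys and chains. -/
lemma exists_chain_involution {K : Type*} [DecidableEq K] (key : ℕ → K) (st : K → K)
    (hst : Function.Involutive st) (hkey : ∀ a, lk a → key a = key (a + 1))
    (hcard : ∀ κ j, ((Finset.range n).filter fun l => key l = κ ∧ j ≤ chainDepth lk l).card =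
      ((Finset.range n).filter fun l => key l = st κ ∧ j ≤ chainDepth lk l).card) :
    ∃ σ : ℕ → ℕ, ∀ a < n, σ a < n ∧ σ (σ a) = a ∧ key (σ a) = st (key a) ∧
      (lk a → lk (σ a) ∧ σ (a + 1) = σ a + 1) := by
  classical
  -- elements of given depth
  have hcard1 : ∀ κ j,
      ((Finset.range n).filter fun l => key l = κ ∧ chainDepth lk l = j).card =
      ((Finset.range n).filter fun l => key l = st κ ∧ chainDepth lk l = j).card := by
    have hsplit : ∀ κ j, ((Finset.range n).filter fun l => key l = κ ∧ j ≤ chainDepth lk l).card =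
        ((Finset.range n).filter fun l => key l = κ ∧ chainDepth lk l = j).card +
        ((Finset.range n).filter fun l => key l = κ ∧ j + 1 ≤ chainDepth lk l).card := by
      intro κ j
      rw [← Finset.card_union_of_disjoint]
      · congr 1
        ext l
        simp only [Finset.mem_filter, Finset.mem_union]
        constructor
        · rintro ⟨h1, h2, h3⟩
          rcases h3.eq_or_lt with h | h
          · exact Or.inl ⟨h1, h2, h.symm⟩
          · exact Or.inr ⟨h1, h2, h⟩
        · rintro (⟨h1, h2, h3⟩ | ⟨h1, h2, h3⟩)
          · exact ⟨h1, h2, h3.ge⟩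
          · exact ⟨h1, h2, by omega⟩
      · rw [Finset.disjoint_left]
        intro l h1 h2
        simp only [Finset.mem_filter] at h1 h2
        omega
    intro κ j
    have h1 := hsplit κ j
    have h2 := hsplit (st κ) j
    have h3 := hcard κ j
    have h4 := hcard κ (j + 1)
    omega
  -- The successor map matches the elements of depth `j` followed by a link with those of depth `j +
  -- 1`. Subtraction leaves the chain ends of depth `j`, each of which stands for a whole chain of
  -- `j + 1` elements.
  have hcard2 : ∀ κ j,
      ((Finset.range n).filter fun l => key l = κ ∧ chainDepth lk l = j ∧ ¬ lk l).card =
      ((Finset.range n).filter fun l => key l = st κ ∧ chainDepth lk l = j ∧ ¬ lk l).card := by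
    have hsplit : ∀ κ j, ((Finset.range n).filter fun l => key l = κ ∧ chainDepth lk l = j).card =
        ((Finset.range n).filter fun l => key l = κ ∧ chainDepth lk l = j ∧ ¬ lk l).card +
        ((Finset.range n).filter fun l => key l = κ ∧ chainDepth lk l = j + 1).card := by
      intro κ j
      have himg : ((Finset.range n).filter fun l => key l = κ ∧ chainDepth lk l = j + 1).card =
          ((Finset.range n).filter fun l => key l = κ ∧ chainDepth lk l = j ∧ lk l).card := by
        symm
        apply Finset.card_bij (fun l _ => l + 1)
        · intro l hl
          simp only [Finset.mem_filter, Finset.mem_range] at hl ⊢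
          obtain ⟨h1, h2, h3, h4⟩ := hl
          exact ⟨hlk _ h4, by rw [← hkey _ h4, h2], by rw [chainDepth_succ_of_link lk h4, h3]⟩
        · intro a _ b _ h
          omega
        · intro l hl
          simp only [Finset.mem_filter, Finset.mem_range] at hl
          obtain ⟨h1, h2, h3⟩ := hl
          obtain ⟨b, rfl, hb⟩ := link_of_chainDepth_pos lk (a := l) (by omega)
          refine ⟨b, ?_, rfl⟩
          simp only [Finset.mem_filter, Finset.mem_range]
          rw [chainDepth_succ_of_link lk hb] at h3
          exact ⟨by omega, by rw [hkey _ hb, h2], by omega, hb⟩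
      rw [himg, ← Finset.card_union_of_disjoint]
      · congr 1
        ext l
        simp only [Finset.mem_filter, Finset.mem_union]
        tauto
      · rw [Finset.disjoint_left]
        intro l h1 h2
        simp only [Finset.mem_filter] at h1 h2
        tauto
    intro κ j
    have h1 := hsplit κ j
    have h2 := hsplit (st κ) j
    have h3 := hcard1 κ j
    have h4 := hcard1 κ (j + 1)
    omega
  let T := {l : Fin n // ¬ lk l}
  let tkey : T → K × ℕ := fun t => (key t.1, chainDepth lk t.1)
  have hfib : ∀ κ : K × ℕ, Fintype.card {t : T // tkey t = κ} =
      ((Finset.range n).filter fun l => key l = κ.1 ∧ chainDepth lk l = κ.2 ∧ ¬ lk l).card := by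
    intro κ
    rw [← Fintype.card_coe]
    apply Fintype.card_congr
    exact
      { toFun := fun t => ⟨t.1.1, by
          have h := t.2
          have h1 : key t.1.1 = κ.1 := congrArg Prod.fst h
          have h2 : chainDepth lk t.1.1 = κ.2 := congrArg Prod.snd h
          simp only [Finset.mem_filter, Finset.mem_range]
          exact ⟨t.1.1.2, h1, h2, t.1.2⟩⟩
        invFun := fun l => by
          have h := Finset.mem_filter.mp l.2
          exact ⟨⟨⟨l.1, Finset.mem_range.mp h.1⟩, h.2.2.2⟩, Prod.ext h.2.1 h.2.2.1⟩
        left_inv := fun t => rfl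
        right_inv := fun l => rfl }
  obtain ⟨σ₀, hσ1, hσ2⟩ := exists_involution_of_card_fiber tkey (fun κ => (st κ.1, κ.2))
    (fun κ => by simp [hst κ.1]) (fun κ => by rw [hfib, hfib]; exact hcard2 κ.1 κ.2)
  have hend : ∀ a < n, a + chainHeight lk a < n := by
    intro a ha
    by_cases h0 : chainHeight lk a = 0
    · omega
    · have := hlk _ (link_of_lt_chainHeight (lk := lk) (a := a) (i := chainHeight lk a - 1)
        (by omega))
      omega
  let en : ∀ a, a < n → T := fun a ha => ⟨⟨a + chainHeight lk a, hend a ha⟩, chainHeight_spec hlk a⟩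
  have hkeyen : ∀ a j, (∀ i < j, lk (a + i)) → key (a + j) = key a := by
    intro a j
    induction j with
    | zero => simp
    | succ j ih =>
      intro h
      rw [← add_assoc, ← hkey _ (h j (by omega)), ih fun i hi => h i (by omega)]
  -- `en a` is the end of the chain of `a`; the image of `a` lies as far below the partner end as
  -- `a` lies below its own. The value for `a ≥ n` is a default that plays no role.
  let σ : ℕ → ℕ := fun a => if h : a < n then (σ₀ (en a h)).1.1 - chainHeight lk a else a
  have hσ : ∀ a (h : a < n), σ a = (σ₀ (en a h)).1.1 - chainHeight lk a := fun a h => dif_pos h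
  have hdep : ∀ a (h : a < n), chainDepth lk (σ₀ (en a h)).1.1 =
      chainDepth lk a + chainHeight lk a := by
    intro a h
    have h1 : chainDepth lk (σ₀ (en a h)).1.1 = chainDepth lk (en a h).1.1 :=
      congrArg Prod.snd (hσ2 (en a h))
    rw [h1]
    exact chainDepth_add a _ fun i hi => link_of_lt_chainHeight hi
  have hlt : ∀ a (_ : a < n), σ a < n := fun a h => by
    rw [hσ a h]
    have := (σ₀ (en a h)).1.2
    omega
  have hheight : ∀ a (_ : a < n), chainHeight lk (σ a) = chainHeight lk a := fun a h => by
    rw [hσ a h]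
    exact chainHeight_sub hlk (σ₀ (en a h)).2 (by rw [hdep a h]; omega)
  have hen : ∀ a (h : a < n), en (σ a) (hlt a h) = σ₀ (en a h) := fun a h => by
    apply Subtype.ext
    apply Fin.ext
    change σ a + chainHeight lk (σ a) = _
    rw [hheight a h, hσ a h]
    have h1 := chainDepth_le lk (σ₀ (en a h)).1.1
    rw [hdep a h] at h1
    omega
  refine ⟨σ, fun a ha => ⟨hlt a ha, ?_, ?_, ?_⟩⟩
  · rw [hσ (σ a) (hlt a ha), hen a ha, hσ1, hheight a ha]
    simp [en]
  · have h1 : key (σ₀ (en a ha)).1.1 = st (key (en a ha).1.1) :=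
      congrArg Prod.fst (hσ2 (en a ha))
    have h2 : key (en a ha).1.1 = key a :=
      hkeyen a _ fun i hi => link_of_lt_chainHeight hi
    have h3 : key (en (σ a) (hlt a ha)).1.1 = key (σ a) :=
      hkeyen (σ a) _ fun i hi => link_of_lt_chainHeight hi
    rw [hen a ha] at h3
    rw [← h3, h1, h2]
  · intro hl
    have h1 := chainHeight_of_link hlk hl
    have h2 := hheight a ha
    constructor
    · have := link_of_lt_chainHeight (lk := lk) (a := σ a) (i := 0) (by omega)
      simpa using this
    · have hen' : en (a + 1) (hlk a hl) = en a ha := by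
        apply Subtype.ext
        apply Fin.ext
        change a + 1 + chainHeight lk (a + 1) = a + chainHeight lk a
        omega
      rw [hσ a ha, hσ (a + 1) (hlk a hl), hen']
      have h3 := chainDepth_le lk (σ₀ (en a ha)).1.1
      rw [hdep a ha] at h3
      omega

end Chains
end QPCocycle

namespace QPCocycle

/-! ### Approximate intertwiners of nilpotent Jordan matrices -/

section Jordan

variable {n : ℕ} (B : Matrix (Fin n) (Fin n) ℂ)

/-- The integer `a` is linked to `a + 1` by a superdiagonal entry of `B`. -/
def jordanLink (a : ℕ) : Prop :=
  ∃ h : a + 1 < n, B ⟨a, (Nat.lt_succ_self a).trans h⟩ ⟨a + 1, h⟩ = 1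

/-- The off-diagonal part of a matrix. -/
def offDiag : Matrix (Fin n) (Fin n) ℂ := Matrix.of fun i j => if i = j then 0 else B i j

lemma diagonal_add_offDiag : Matrix.diagonal (fun i => B i i) + offDiag B = B := by
  ext i j
  by_cases h : i = j
  · subst h; simp [offDiag]
  · simp [offDiag, h]

lemma jordanLink_lt (a : ℕ) (h : jordanLink B a) : a + 1 < n := h.1

variable {B}

lemma jordanLink_diag (hB : IsJordanForm B) {i j : Fin n} (hij : (j : ℕ) = i + 1)
    (h : jordanLink B i) : B i i = B j j := by
  obtain ⟨h1, h2⟩ := h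
  have hj : j = ⟨(i : ℕ) + 1, h1⟩ := Fin.ext hij
  have hne : i ≠ j := fun h => by rw [h] at hij; omega
  have h3 : B i j = 1 := by rw [hj]; exact h2
  rcases hB i j hne with h | ⟨_, _, h⟩
  · rw [h3] at h; exact absurd h one_ne_zero
  · exact h

open Classical in
lemma offDiag_apply (hB : IsJordanForm B) (i j : Fin n) :
    offDiag B i j = if (j : ℕ) = i + 1 ∧ jordanLink B i then 1 else 0 := by
  unfold offDiag
  simp only [Matrix.of_apply]
  by_cases hij : i = j
  · subst hij; simp
  rw [if_neg hij]
  by_cases hc : (j : ℕ) = i + 1 ∧ jordanLink B i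
  · rw [if_pos hc]
    obtain ⟨h0, h1, h2⟩ := hc
    have hj : j = ⟨(i : ℕ) + 1, h1⟩ := Fin.ext h0
    rw [hj]; exact h2
  · rw [if_neg hc]
    rcases hB i j hij with h | ⟨h1, h2, _⟩
    · exact h
    · refine absurd ⟨h1, ⟨by omega, ?_⟩⟩ hc
      have hj : j = ⟨(i : ℕ) + 1, by omega⟩ := Fin.ext h1
      rw [← h2]; congr 1; exact hj.symm

-- Powers of the nilpotent part detect depth: a row of the `m`-th power picks out the index `m`
-- steps further along, exactly when that index has depth at least `m`.
open Classical in
lemma offDiag_pow_apply (hB : IsJordanForm B) (m : ℕ) (i l : Fin n) :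
    (offDiag B ^ m) i l =
      if (l : ℕ) = i + m ∧ m ≤ chainDepth (jordanLink B) l then 1 else 0 := by
  induction m generalizing l with
  | zero =>
    simp [Matrix.one_apply, Fin.ext_iff, eq_comm]
  | succ m ih =>
    rw [pow_succ, Matrix.mul_apply]
    simp_rw [ih, offDiag_apply hB]
    by_cases hl : ∃ b : Fin n, (l : ℕ) = b + 1 ∧ jordanLink B b
    · obtain ⟨b, hb, hlb⟩ := hl
      rw [Finset.sum_eq_single b]
      · rw [hb, chainDepth_succ_of_link _ hlb]
        simp only [hlb, and_self, if_true, mul_one]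
        congr 1
        apply propext
        constructor <;> rintro ⟨h1, h2⟩ <;> constructor <;> omega
      · intro c _ hc
        have : ¬ ((l : ℕ) = c + 1 ∧ jordanLink B c) := fun h => hc (Fin.ext (by omega))
        rw [if_neg this, mul_zero]
      · simp
    · rw [Finset.sum_eq_zero, if_neg]
      · rintro ⟨h1, h2⟩
        obtain ⟨b, hb, hlb⟩ := link_of_chainDepth_pos (jordanLink B) (a := l) (by omega)
        exact hl ⟨⟨b, by omega⟩, hb, hlb⟩
      · intro c _
        rw [if_neg (fun h => hl ⟨c, h⟩), mul_zero]

lemma norm_offDiag_pow_le (hB : IsJordanForm B) (m : ℕ) (i l : Fin n) :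
    ‖(offDiag B ^ m) i l‖ ≤ 1 := by
  classical
  rw [offDiag_pow_apply hB]
  split_ifs <;> simp

lemma norm_mul_apply_le {a b : ℝ} {X Y : Matrix (Fin n) (Fin n) ℂ}
    (hX : ∀ i j, ‖X i j‖ ≤ a) (hY : ∀ i j, ‖Y i j‖ ≤ b) (i j : Fin n) :
    ‖(X * Y) i j‖ ≤ n * (a * b) := by
  have ha : 0 ≤ a := (norm_nonneg _).trans (hX i i)
  rw [Matrix.mul_apply]
  refine (norm_sum_le _ _).trans ?_
  calc ∑ l, ‖X i l * Y l j‖ ≤ ∑ _l : Fin n, a * b :=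
        Finset.sum_le_sum fun l _ => by
          rw [norm_mul]; exact mul_le_mul (hX i l) (hY l j) (norm_nonneg _) ha
    _ = n * (a * b) := by simp

lemma norm_mulVec_apply_le {a b : ℝ} {X : Matrix (Fin n) (Fin n) ℂ} {y : Fin n → ℂ}
    (hX : ∀ i j, ‖X i j‖ ≤ a) (hY : ∀ j, ‖y j‖ ≤ b) (i : Fin n) :
    ‖(X.mulVec y) i‖ ≤ n * (a * b) := by
  have ha : 0 ≤ a := (norm_nonneg _).trans (hX i i)
  rw [Matrix.mulVec, dotProduct]
  refine (norm_sum_le _ _).trans ?_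
  calc ∑ l, ‖X i l * y l‖ ≤ ∑ _l : Fin n, a * b :=
        Finset.sum_le_sum fun l _ => by
          rw [norm_mul]; exact mul_le_mul (hX i l) (hY l) (norm_nonneg _) ha
    _ = n * (a * b) := by simp

/-- With `J` the nilpotent part, `[J ^ (m + 1), V] = J ^ m [J, V] + [J ^ m, V] J`. Each of the two
products costs a factor `n`, hence `2 * n` per step. -/
lemma norm_offDiag_pow_commutator_le (hB : IsJordanForm B) {V : Matrix (Fin n) (Fin n) ℂ} {γ : ℝ}
    (hγ : ∀ i j, ‖(offDiag B * V - V * offDiag B) i j‖ ≤ γ) (m : ℕ) (i j : Fin n) :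
    ‖(offDiag B ^ m * V - V * offDiag B ^ m) i j‖ ≤ (2 * n) ^ m * γ := by
  have hγ0 : 0 ≤ γ := (norm_nonneg _).trans (hγ i j)
  have hn : (1 : ℝ) ≤ n := by exact_mod_cast Nat.one_le_iff_ne_zero.mpr (fun h => by
    subst h; exact i.elim0)
  induction m generalizing i j with
  | zero => simpa using hγ0
  | succ m ih =>
    have hid : offDiag B ^ (m + 1) * V - V * offDiag B ^ (m + 1) =
        offDiag B ^ m * (offDiag B * V - V * offDiag B) +
          (offDiag B ^ m * V - V * offDiag B ^ m) * offDiag B := by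
      rw [pow_succ]; noncomm_ring
    have h1 := norm_mul_apply_le (norm_offDiag_pow_le hB m) hγ i j
    have h2 := norm_mul_apply_le ih (fun i j => by simpa using norm_offDiag_pow_le hB 1 i j) i j
    rw [hid, Matrix.add_apply]
    refine (norm_add_le _ _).trans ((add_le_add h1 h2).trans ?_)
    have h3 : γ ≤ (2 * n) ^ m * γ := le_mul_of_one_le_left hγ0 (one_le_pow₀ (by linarith))
    calc (n : ℝ) * (1 * γ) + n * ((2 * n) ^ m * γ * 1)
        ≤ n * ((2 * n) ^ m * γ) + n * ((2 * n) ^ m * γ) := by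
          rw [one_mul, mul_one]; gcongr
      _ = (2 * n) ^ (m + 1) * γ := by ring

variable {K : Type*} {key : Fin n → K} {st : K → K}

/-- An approximately invertible matrix which maps the class of `κ` to that of `st κ` and almost
commutes with the nilpotent part gives an inequality between numbers of entries of given depth. -/
lemma card_depth_le (hB : IsJordanForm B) {V Y : Matrix (Fin n) (Fin n) ℂ} {η γ u : ℝ}
    (hkey : ∀ i j : Fin n, (j : ℕ) = i + 1 → jordanLink B i → key i = key j)
    (hV : ∀ i j, V i j ≠ 0 → key j = st (key i))
    (hη : ∀ i j, ‖(1 - V * Y) i j‖ ≤ η)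
    (hγ : ∀ i j, ‖(offDiag B * V - V * offDiag B) i j‖ ≤ γ)
    (hu : ∀ i j, ‖Y i j‖ ≤ u)
    (hsmall : n * η + n ^ 2 * (2 * n) ^ n * (γ * u) < 1) (κ : K) (m : ℕ)
    [Fintype {l : Fin n // key l = κ ∧ m ≤ chainDepth (jordanLink B) l}]
    [Fintype {l : Fin n // key l = st κ ∧ m ≤ chainDepth (jordanLink B) l}] :
    Fintype.card {l : Fin n // key l = κ ∧ m ≤ chainDepth (jordanLink B) l} ≤
      Fintype.card {l : Fin n // key l = st κ ∧ m ≤ chainDepth (jordanLink B) l} := by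
  classical
  set S := {l : Fin n // key l = κ ∧ m ≤ chainDepth (jordanLink B) l} with hS
  set S' := {l : Fin n // key l = st κ ∧ m ≤ chainDepth (jordanLink B) l} with hS'
  -- The cardinalities are compared as dimensions, through the block of `Y` with columns in `S` and
  -- rows in `S'`. A kernel vector will be bounded by a multiple less than one of its own norm.
  let f : (S → ℂ) →ₗ[ℂ] (S' → ℂ) :=
    (Y.submatrix (Subtype.val : S' → Fin n) (Subtype.val : S → Fin n)).mulVecLin
  suffices hf : Function.Injective f by
    have := LinearMap.finrank_le_finrank_of_injective hf
    simp only [Module.finrank_fintype_fun_eq_card] at this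
    convert this
  have hkeyd : ∀ (m : ℕ) (i l : Fin n), (l : ℕ) = i + m → m ≤ chainDepth (jordanLink B) l →
      key i = key l := by
    intro m
    induction m with
    | zero => intro i l h _; rw [Fin.ext (by omega : (l : ℕ) = i)]
    | succ m ih =>
      intro i l h hd
      obtain ⟨b, hb, hlb⟩ := link_of_chainDepth_pos (jordanLink B) (a := l) (by omega)
      have hbn : b < n := by omega
      rw [hb, chainDepth_succ_of_link _ hlb] at hd
      rw [ih i ⟨b, hbn⟩ (by simp only; omega) (by simp only; omega)]
      exact hkey ⟨b, hbn⟩ l hb hlb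
  rw [← LinearMap.ker_eq_bot, LinearMap.ker_eq_bot']
  intro x hx
  let xe : Fin n → ℂ := fun i =>
    if h : key i = κ ∧ m ≤ chainDepth (jordanLink B) i then x ⟨i, h⟩ else 0
  have hxeS : ∀ l : S, xe l = x l := fun l => dif_pos l.2
  have hxe : ∀ i, ‖xe i‖ ≤ ‖x‖ := by
    intro i
    simp only [xe]
    split_ifs with h
    · exact norm_le_pi_norm x _
    · simp
  set y : Fin n → ℂ := Y.mulVec xe with hy
  have hyS' : ∀ l : S', y l = 0 := by
    intro l
    have h1 : f x l = 0 := by rw [hx]; rfl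
    rw [← h1, hy]
    change ∑ i, Y l i * xe i = ∑ i : S, Y l i * x i
    rw [← Fintype.sum_subtype_add_sum_subtype
      (fun i => key i = κ ∧ m ≤ chainDepth (jordanLink B) i)]
    rw [Finset.sum_eq_zero (s := (Finset.univ : Finset {i // ¬ _})), add_zero]
    · exact Finset.sum_congr (by ext; simp) fun i _ => by rw [← hxeS i]
    · intro i _
      simp only [xe]
      rw [dif_neg i.2, mul_zero]
  have hyb : ∀ i, ‖y i‖ ≤ n * (u * ‖x‖) := norm_mulVec_apply_le hu hxe
  have hx0 : ‖x‖ = 0 := by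
    by_contra hne
    have hpos : 0 < ‖x‖ := lt_of_le_of_ne (norm_nonneg _) (Ne.symm hne)
    have hle : ‖x‖ ≤ (n * η + n ^ 2 * (2 * n) ^ n * (γ * u)) * ‖x‖ := by
      have hnonneg : 0 ≤ (n * η + n ^ 2 * (2 * n) ^ n * (γ * u)) * ‖x‖ := by
        rcases Nat.eq_zero_or_pos n with rfl | hn
        · simp
        · have hη0 := (norm_nonneg _).trans (hη ⟨0, hn⟩ ⟨0, hn⟩)
          have hγ0 := (norm_nonneg _).trans (hγ ⟨0, hn⟩ ⟨0, hn⟩)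
          have hu0 := (norm_nonneg _).trans (hu ⟨0, hn⟩ ⟨0, hn⟩)
          positivity
      rw [pi_norm_le_iff_of_nonneg hnonneg]
      intro l
      have hn : 0 < n := (Nat.zero_le _).trans_lt l.1.2
      have hη0 := (norm_nonneg _).trans (hη ⟨0, hn⟩ ⟨0, hn⟩)
      have hγ0 := (norm_nonneg _).trans (hγ ⟨0, hn⟩ ⟨0, hn⟩)
      have hu0 := (norm_nonneg _).trans (hu ⟨0, hn⟩ ⟨0, hn⟩)
      have hml : m ≤ (l.1 : ℕ) := l.2.2.trans (chainDepth_le _ _)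
      let i : Fin n := ⟨(l.1 : ℕ) - m, by omega⟩
      have hil : (l.1 : ℕ) = i + m := by simp only [i]; omega
      have hrow : ∀ z : Fin n → ℂ, ((offDiag B ^ m).mulVec z) i = z l := by
        intro z
        change ∑ j, (offDiag B ^ m) i j * z j = z l
        rw [Finset.sum_eq_single l.1]
        · rw [offDiag_pow_apply hB, if_pos ⟨hil, l.2.2⟩, one_mul]
        · intro j _ hj
          rw [offDiag_pow_apply hB, if_neg, zero_mul]
          rintro ⟨h, _⟩
          exact hj (Fin.ext (by omega))
        · simp
      -- Row `i` of `V` only sees the class `st κ`; there the `m`-th power reads `y` at indices of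
      -- depth at least `m`, which lie in `S'`, where `y` vanishes.
      have hVN : (V.mulVec ((offDiag B ^ m).mulVec y)) i = 0 := by
        change ∑ j, V i j * ((offDiag B ^ m).mulVec y) j = 0
        refine Finset.sum_eq_zero fun j _ => ?_
        by_cases hVij : V i j = 0
        · rw [hVij, zero_mul]
        have hj : key j = st κ := by
          rw [hV i j hVij, hkeyd m i l hil l.2.2, l.2.1]
        have : ((offDiag B ^ m).mulVec y) j = 0 := by
          change ∑ l', (offDiag B ^ m) j l' * y l' = 0
          refine Finset.sum_eq_zero fun l' _ => ?_
          rw [offDiag_pow_apply hB]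
          split_ifs with h
          · rw [one_mul]
            exact hyS' ⟨l', by rw [← hkeyd m j l' h.1 h.2, hj], h.2⟩
          · rw [zero_mul]
        rw [this, mul_zero]
      have hdec : xe = (1 - V * Y).mulVec xe + V.mulVec y := by
        rw [hy, Matrix.mulVec_mulVec, Matrix.sub_mulVec, Matrix.one_mulVec, sub_add_cancel]
      -- The vanishing above lets `(V y) l`, which is row `i = l - m` of `offDiag B ^ m * V` applied
      -- to `y`, be replaced by a commutator. Both terms are now small.
      have hkey1 : x l = ((1 - V * Y).mulVec xe) l +
          ((offDiag B ^ m * V - V * offDiag B ^ m).mulVec y) i := by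
        have e1 : ((offDiag B ^ m * V - V * offDiag B ^ m).mulVec y) i = (V.mulVec y) l := by
          rw [Matrix.sub_mulVec, ← Matrix.mulVec_mulVec, ← Matrix.mulVec_mulVec, Pi.sub_apply,
            hVN, sub_zero, hrow]
        rw [e1, ← hxeS l]
        exact congrFun hdec l.1
      rw [hkey1]
      have b1 := norm_mulVec_apply_le hη hxe l.1
      have b2 := norm_mulVec_apply_le (norm_offDiag_pow_commutator_le hB hγ m) hyb i
      refine (norm_add_le _ _).trans ((add_le_add b1 b2).trans ?_)
      have hmn : m ≤ n := by omega
      have hn1 : (1 : ℝ) ≤ 2 * n := by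
        have : (1 : ℝ) ≤ n := by exact_mod_cast hn
        linarith
      have hpow : (2 * n : ℝ) ^ m ≤ (2 * n) ^ n := pow_le_pow_right₀ hn1 hmn
      calc n * (η * ‖x‖) + n * ((2 * n) ^ m * γ * (n * (u * ‖x‖)))
          ≤ n * (η * ‖x‖) + n * ((2 * n) ^ n * γ * (n * (u * ‖x‖))) := by gcongr
        _ = _ := by ring
    nlinarith
  exact norm_eq_zero.mp hx0

lemma card_filter_range_eq_card_subtype (p : ℕ → Prop) [DecidablePred p]
    [Fintype {l : Fin n // p l}] :
    ((Finset.range n).filter p).card = Fintype.card {l : Fin n // p l} := by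
  rw [← Fintype.card_coe]
  apply Fintype.card_congr
  exact
    { toFun := fun l => ⟨⟨l.1, Finset.mem_range.mp (Finset.mem_filter.mp l.2).1⟩,
        (Finset.mem_filter.mp l.2).2⟩
      invFun := fun l => ⟨l.1, Finset.mem_filter.mpr ⟨Finset.mem_range.mpr l.1.2, l.2⟩⟩
      left_inv := fun t => rfl
      right_inv := fun l => rfl }

/-- In the situation of an approximate intertwiner there is an involution of the indices which
matches Jordan blocks and realizes the involution of the keys. -/
lemma exists_jordan_involution (hn : 0 < n) (hB : IsJordanForm B)
    {V Y : Matrix (Fin n) (Fin n) ℂ} {η γ u : ℝ} (hst : Function.Involutive st)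
    (hkey : ∀ i j : Fin n, (j : ℕ) = i + 1 → jordanLink B i → key i = key j)
    (hV : ∀ i j, V i j ≠ 0 → key j = st (key i))
    (hη : ∀ i j, ‖(1 - V * Y) i j‖ ≤ η)
    (hγ : ∀ i j, ‖(offDiag B * V - V * offDiag B) i j‖ ≤ γ)
    (hu : ∀ i j, ‖Y i j‖ ≤ u)
    (hsmall : n * η + n ^ 2 * (2 * n) ^ n * (γ * u) < 1) :
    ∃ σ : Fin n → Fin n, Function.Involutive σ ∧ (∀ i, key (σ i) = st (key i)) ∧
      ∀ i j : Fin n, (j : ℕ) = i + 1 → jordanLink B i →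
        (σ j : ℕ) = σ i + 1 ∧ jordanLink B (σ i) := by
  classical
  -- The chain lemmas live on `ℕ`. The value beyond `n` is arbitrary, since only indices below `n`
  -- are counted.
  let key' : ℕ → K := fun a => if h : a < n then key ⟨a, h⟩ else key ⟨0, hn⟩
  have hkey' : ∀ i : Fin n, key' i = key i := fun i => dif_pos i.2
  have hcard : ∀ κ j, ((Finset.range n).filter
        fun l => key' l = κ ∧ j ≤ chainDepth (jordanLink B) l).card =
      Fintype.card {l : Fin n // key l = κ ∧ j ≤ chainDepth (jordanLink B) l} := by
    intro κ j
    rw [card_filter_range_eq_card_subtype]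
    exact Fintype.card_congr (Equiv.subtypeEquivRight fun l => by rw [hkey'])
  obtain ⟨σ, hσ⟩ := exists_chain_involution (jordanLink_lt B) key' st hst
    (fun a ha => by
      have h1 := jordanLink_lt B a ha
      have := hkey ⟨a, by omega⟩ ⟨a + 1, h1⟩ rfl ha
      rwa [← hkey', ← hkey'] at this)
    (fun κ j => by
      rw [hcard, hcard]
      apply le_antisymm
      · exact card_depth_le hB hkey hV hη hγ hu hsmall κ j
      -- The same `V` serves for the opposite class, and `st` being an involution gives the reverse
      -- inequality.
      · have := card_depth_le hB hkey hV hη hγ hu hsmall (st κ) j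
        simpa only [hst κ] using this)
  refine ⟨fun i => ⟨σ i, (hσ i i.2).1⟩, fun i => Fin.ext (hσ i i.2).2.1, fun i => ?_,
    fun i j hij hl => ?_⟩
  · have := (hσ i i.2).2.2.1
    rw [hkey'] at this
    rw [← this, ← hkey']
  · obtain ⟨h1, h2⟩ := (hσ i i.2).2.2.2 hl
    exact ⟨by simp only [hij, h2], h1⟩

end Jordan
end QPCocycle

namespace QPCocycle

/-! ### Trigonometric polynomials -/

section TrigPoly

variable {d : ℕ}

/-- The character `exp (2πi ⟨k, θ⟩)`. -/
noncomputable def torusChar (k : Fin d → ℤ) (θ : Fin d → ℝ) : ℂ :=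
  Complex.exp (2 * Real.pi * Complex.I * ∑ a, (k a : ℂ) * (θ a : ℂ))

/-- The value `2πi ⟨k, v⟩` of the derivative of a character along `v`. -/
noncomputable def charFreq (k : Fin d → ℤ) (v : Fin d → ℝ) : ℂ :=
  2 * Real.pi * Complex.I * ∑ a, (k a : ℂ) * (v a : ℂ)

lemma charFreq_eq (k : Fin d → ℤ) (v : Fin d → ℝ) :
    charFreq k v = ((2 * Real.pi * ∑ a, (k a : ℝ) * v a : ℝ) : ℂ) * Complex.I := by
  simp only [charFreq]; push_cast; ring

lemma charFreq_add (k l : Fin d → ℤ) (v : Fin d → ℝ) :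
    charFreq (k + l) v = charFreq k v + charFreq l v := by
  simp only [charFreq, Pi.add_apply, Int.cast_add, add_mul, Finset.sum_add_distrib]; ring

lemma charFreq_neg (k : Fin d → ℤ) (v : Fin d → ℝ) : charFreq (-k) v = -charFreq k v := by
  simp [charFreq]

@[simp] lemma charFreq_zero (v : Fin d → ℝ) : charFreq 0 v = 0 := by simp [charFreq]

lemma conj_charFreq (k : Fin d → ℤ) (v : Fin d → ℝ) :
    (starRingEnd ℂ) (charFreq k v) = -charFreq k v := by
  rw [charFreq_eq, map_mul, Complex.conj_ofReal, Complex.conj_I, mul_neg]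

lemma charFreq_smul (k : Fin d → ℤ) (t : ℝ) (v : Fin d → ℝ) :
    charFreq k (t • v) = t * charFreq k v := by
  simp only [charFreq, Pi.smul_apply, smul_eq_mul, Complex.ofReal_mul, Finset.mul_sum]
  exact Finset.sum_congr rfl fun a _ => by ring

lemma charFreq_single (k : Fin d → ℤ) (a : Fin d) :
    charFreq k (Pi.single a 1) = 2 * Real.pi * Complex.I * k a := by
  simp only [charFreq]
  rw [Finset.sum_eq_single a]
  · simp
  · intro b _ hb
    simp [Pi.single_eq_of_ne hb]
  · simp

lemma torusChar_add_smul (k : Fin d → ℤ) (θ v : Fin d → ℝ) (t : ℝ) :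
    torusChar k (θ + t • v) = torusChar k θ * Complex.exp (t * charFreq k v) := by
  rw [torusChar, torusChar, ← Complex.exp_add, charFreq]
  congr 1
  simp only [Pi.add_apply, Pi.smul_apply, smul_eq_mul, Complex.ofReal_add, Complex.ofReal_mul,
    mul_add, Finset.sum_add_distrib, Finset.mul_sum]
  congr 1
  exact Finset.sum_congr rfl fun a _ => by ring

lemma isTorusFun_torusChar (k : Fin d → ℤ) : IsTorusFun (torusChar k) := by
  intro θ l
  have : (θ + fun i => (l i : ℝ)) = θ + (1 : ℝ) • fun i => (l i : ℝ) := by simp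
  rw [this, torusChar_add_smul]
  have h : Complex.exp ((1 : ℝ) * charFreq k fun i => (l i : ℝ)) = 1 := by
    rw [Complex.exp_eq_one_iff]
    refine ⟨∑ a, k a * l a, ?_⟩
    simp [charFreq]
    ring
  rw [h, mul_one]

lemma norm_torusChar (k : Fin d → ℤ) (θ : Fin d → ℝ) : ‖torusChar k θ‖ = 1 := by
  have : torusChar k θ = Complex.exp (charFreq k θ) := rfl
  rw [this, charFreq_eq, Complex.norm_exp_ofReal_mul_I]

lemma torusChar_neg_mul (k : Fin d → ℤ) (θ : Fin d → ℝ) :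
    torusChar k θ * torusChar (-k) θ = 1 := by
  have h : ∀ k, torusChar k θ = Complex.exp (charFreq k θ) := fun _ => rfl
  rw [h, h, charFreq_neg, ← Complex.exp_add, add_neg_cancel, Complex.exp_zero]

variable {E : Type*} [NormedAddCommGroup E] [NormedSpace ℂ E] [NormedSpace ℝ E]
  [IsScalarTower ℝ ℂ E] {ι : Type*} [Fintype ι]

/-- A trigonometric polynomial with frequencies `m i` and coefficients `A i`. -/
noncomputable def trigPoly (m : ι → Fin d → ℤ) (A : ι → E) (θ : Fin d → ℝ) : E :=
  ∑ i, torusChar (m i) θ • A i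

omit [NormedSpace ℝ E] [IsScalarTower ℝ ℂ E] in
lemma isTorusFun_trigPoly (m : ι → Fin d → ℤ) (A : ι → E) : IsTorusFun (trigPoly m A) := by
  intro θ k
  simp only [trigPoly, isTorusFun_torusChar _ θ k]

lemma contDiff_torusChar (k : Fin d → ℤ) {r : WithTop ℕ∞} : ContDiff ℝ r (torusChar k) := by
  unfold torusChar
  refine Complex.contDiff_exp.comp (contDiff_const.mul (ContDiff.sum fun a _ => ?_))
  exact contDiff_const.mul (Complex.ofRealCLM.contDiff.comp (contDiff_apply ℝ ℝ a))

lemma contDiff_trigPoly (m : ι → Fin d → ℤ) (A : ι → E) {r : WithTop ℕ∞} :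
    ContDiff ℝ r (trigPoly m A) :=
  ContDiff.sum fun i _ => (contDiff_torusChar (m i)).smul contDiff_const

lemma dirDeriv_trigPoly (v : Fin d → ℝ) (m : ι → Fin d → ℤ) (A : ι → E) :
    dirDeriv v (trigPoly m A) = trigPoly m fun i => charFreq (m i) v • A i := by
  funext θ
  unfold dirDeriv
  apply HasLineDerivAt.lineDeriv
  unfold HasLineDerivAt trigPoly
  refine HasDerivAt.fun_sum fun i _ => ?_
  simp_rw [torusChar_add_smul]
  have h1 : HasDerivAt (fun t : ℝ => (t : ℂ) * charFreq (m i) v) (charFreq (m i) v) 0 := by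
    simpa using (Complex.ofRealCLM.hasDerivAt (x := (0 : ℝ))).mul_const (charFreq (m i) v)
  have h2 := (h1.cexp.const_mul (torusChar (m i) θ)).smul_const (A i)
  simpa [mul_smul] using h2

lemma multiDeriv_trigPoly (α : Fin d → ℕ) (m : ι → Fin d → ℤ) (A : ι → E) :
    multiDeriv α (trigPoly m A) =
      trigPoly m fun i => (∏ a, charFreq (m i) (Pi.single a 1) ^ α a) • A i := by
  have hiter : ∀ (v : Fin d → ℝ) (r : ℕ) (A : ι → E), (dirDeriv v)^[r] (trigPoly m A) =
      trigPoly m fun i => charFreq (m i) v ^ r • A i := by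
    intro v r
    induction r with
    | zero => intro A; simp
    | succ r ih =>
      intro A
      rw [Function.iterate_succ_apply, dirDeriv_trigPoly, ih]
      simp only [smul_smul, pow_succ]
  have hlist : ∀ l : List (Fin d),
      l.foldr (fun i g => (dirDeriv (Pi.single i (1 : ℝ)))^[α i] g) (trigPoly m A) =
      trigPoly m fun i => (l.map fun a => charFreq (m i) (Pi.single a 1) ^ α a).prod • A i := by
    intro l
    induction l with
    | nil => simp
    | cons b l ih =>
      rw [List.foldr_cons, ih, hiter]
      simp only [smul_smul, List.map_cons, List.prod_cons]
  rw [multiDeriv, hlist]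
  simp only [← List.ofFn_eq_map, List.prod_ofFn]

lemma norm_charFreq_single_le {k : Fin d → ℤ} {a : Fin d} {M : ℝ} (h : |(k a : ℝ)| ≤ M) :
    ‖charFreq k (Pi.single a 1)‖ ≤ 2 * Real.pi * M := by
  rw [charFreq_single]
  simp only [norm_mul, Complex.norm_I, mul_one, Complex.norm_real, Complex.norm_ofNat,
    Real.norm_eq_abs, abs_of_pos Real.pi_pos, Complex.norm_intCast]
  gcongr

end TrigPoly

/-! ### Norms of matrices -/

section MatrixNorm

variable {n : ℕ}

lemma norm_entry_le_l2_opNorm (A : Matrix (Fin n) (Fin n) ℂ) (i j : Fin n) : ‖A i j‖ ≤ ‖A‖ := by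
  have h := Matrix.l2_opNorm_mulVec A (EuclideanSpace.single j (1 : ℂ))
  have h2 : A i j = (WithLp.toLp 2 (A.mulVec (EuclideanSpace.single j (1 : ℂ)).ofLp) :
      EuclideanSpace ℂ (Fin n)) i := by
    simp [EuclideanSpace.single]
  rw [h2]
  refine (PiLp.norm_apply_le _ i).trans (h.trans ?_)
  simp

lemma l2_opNorm_le_of_entry_le {A : Matrix (Fin n) (Fin n) ℂ} {c : ℝ} (hc : 0 ≤ c)
    (h : ∀ i j, ‖A i j‖ ≤ c) : ‖A‖ ≤ n * c := by
  rw [Matrix.l2_opNorm_def]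
  refine ContinuousLinearMap.opNorm_le_bound _ (by positivity) fun x => ?_
  have hx : ∀ j, ‖x j‖ ≤ ‖x‖ := fun j => PiLp.norm_apply_le x j
  rw [EuclideanSpace.norm_eq]
  apply Real.sqrt_le_iff.mpr
  refine ⟨by positivity, ?_⟩
  have hrow : ∀ i, ‖(A.mulVec x.ofLp) i‖ ^ 2 ≤ n * (c * ‖x‖) ^ 2 := by
    intro i
    rw [Matrix.mulVec, dotProduct]
    have h1 : ‖∑ j, A i j * x j‖ ≤ c * ∑ j, ‖x j‖ := by
      refine (norm_sum_le _ _).trans ?_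
      rw [Finset.mul_sum]
      exact Finset.sum_le_sum fun j _ => by
        rw [norm_mul]; exact mul_le_mul_of_nonneg_right (h i j) (norm_nonneg _)
    have h2 : (∑ j, ‖x j‖) ^ 2 ≤ n * ∑ j, ‖x j‖ ^ 2 := by
      simpa using sq_sum_le_card_mul_sum_sq (s := (Finset.univ : Finset (Fin n)))
        (f := fun j => ‖x j‖)
    have h3 : ∑ j, ‖x j‖ ^ 2 = ‖x‖ ^ 2 := (EuclideanSpace.norm_sq_eq x).symm
    calc ‖∑ j, A i j * x j‖ ^ 2 ≤ (c * ∑ j, ‖x j‖) ^ 2 :=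
          pow_le_pow_left₀ (norm_nonneg _) h1 2
      _ = c ^ 2 * (∑ j, ‖x j‖) ^ 2 := by ring
      _ ≤ c ^ 2 * (n * ‖x‖ ^ 2) := by rw [← h3]; gcongr
      _ = n * (c * ‖x‖) ^ 2 := by ring
  calc _ ≤ ∑ _i : Fin n, (n : ℝ) * (c * ‖x‖) ^ 2 := Finset.sum_le_sum fun i _ => hrow i
    _ = (n * c * ‖x‖) ^ 2 := by simp; ring

lemma norm_le_one_of_mem_unitaryGroup {P : Matrix (Fin n) (Fin n) ℂ}
    (hP : P ∈ Matrix.unitaryGroup (Fin n) ℂ) : ‖P‖ ≤ 1 := by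
  have h1 : ‖star P * P‖ = ‖P‖ * ‖P‖ := CStarRing.norm_star_mul_self
  have h2 : star P * P = 1 := (Matrix.mem_unitaryGroup_iff').mp hP
  have h3 : ‖(1 : Matrix (Fin n) (Fin n) ℂ)‖ ≤ 1 := by
    rw [← Matrix.diagonal_one, Matrix.l2_opNorm_diagonal]
    exact (pi_norm_le_iff_of_nonneg zero_le_one).mpr fun i => by simp
  rw [h2] at h1
  nlinarith [norm_nonneg P]

end MatrixNorm
end QPCocycle

namespace QPCocycle

/-! ### The real form attached to an involution of the Jordan blocks -/

section Involution

variable {n : ℕ}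

lemma conjMat_mul (A B : Matrix (Fin n) (Fin n) ℂ) :
    conjMat (A * B) = conjMat A * conjMat B := Matrix.map_mul

/-- The permutation matrix of a self-map of the indices. -/
def involMat (σ : Fin n → Fin n) : Matrix (Fin n) (Fin n) ℂ :=
  Matrix.of fun i j => if σ i = j then 1 else 0

/-- A symmetric unitary square root of the permutation matrix of an involution. -/
noncomputable def involRoot (σ : Fin n → Fin n) : Matrix (Fin n) (Fin n) ℂ :=
  ((1 + Complex.I) / 2) • 1 + ((1 - Complex.I) / 2) • involMat σ

lemma involMat_mul_apply (σ : Fin n → Fin n) (A : Matrix (Fin n) (Fin n) ℂ) (i j : Fin n) :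
    (involMat σ * A) i j = A (σ i) j := by
  simp [involMat, Matrix.mul_apply]

lemma mul_involMat_apply {σ : Fin n → Fin n} (hσ : Function.Involutive σ)
    (A : Matrix (Fin n) (Fin n) ℂ) (i j : Fin n) : (A * involMat σ) i j = A i (σ j) := by
  have h : ∀ l, (σ l = j) = (l = σ j) := fun l => by
    apply propext
    constructor
    · rintro rfl; rw [hσ]
    · rintro rfl; rw [hσ]
  simp [involMat, Matrix.mul_apply, h]

lemma involMat_mul_self {σ : Fin n → Fin n} (hσ : Function.Involutive σ) :
    involMat σ * involMat σ = 1 := by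
  ext i j
  rw [involMat_mul_apply]
  simp [involMat, hσ i, Matrix.one_apply]

lemma star_involMat {σ : Fin n → Fin n} (hσ : Function.Involutive σ) :
    star (involMat σ) = involMat σ := by
  ext i j
  rw [Matrix.star_apply]
  have h : (σ j = i) = (σ i = j) := by
    apply propext
    constructor
    · rintro rfl; rw [hσ]
    · rintro rfl; rw [hσ]
  simp only [involMat, Matrix.of_apply, h]
  split_ifs <;> simp

lemma star_involRoot {σ : Fin n → Fin n} (hσ : Function.Involutive σ) :
    star (involRoot σ) =
      ((1 - Complex.I) / 2) • 1 + ((1 + Complex.I) / 2) • involMat σ := by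
  rw [involRoot, star_add, star_smul, star_smul, star_involMat hσ, star_one]
  congr 2 <;> simp [sub_eq_add_neg]

/-- `involRoot σ` is symmetric, so its entrywise conjugate is its adjoint. -/
lemma conjMat_involRoot {σ : Fin n → Fin n} (hσ : Function.Involutive σ) :
    conjMat (involRoot σ) = star (involRoot σ) := by
  rw [star_involRoot hσ]
  ext i j
  simp only [conjMat, involRoot, involMat, Matrix.map_apply, Matrix.add_apply, Matrix.smul_apply,
    Matrix.one_apply, Matrix.of_apply]
  split_ifs <;> simp [sub_eq_add_neg, map_ofNat (starRingEnd ℂ) 2]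

lemma conjMat_star_involRoot {σ : Fin n → Fin n} (hσ : Function.Involutive σ) :
    conjMat (star (involRoot σ)) = involRoot σ := by
  rw [← conjMat_involRoot hσ]
  ext i j
  simp [conjMat]

lemma complex_coeff_identity :
    ((1 + Complex.I) / 2) * ((1 + Complex.I) / 2) + ((1 - Complex.I) / 2) * ((1 - Complex.I) / 2)
      = 0 := by
  linear_combination (1 / 2 : ℂ) * Complex.I_mul_I

lemma complex_coeff_identity' : ((1 + Complex.I) / 2) * ((1 - Complex.I) / 2) = 1 / 2 := by
  linear_combination (-1 / 4 : ℂ) * Complex.I_mul_I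

lemma involRoot_mul_star {σ : Fin n → Fin n} (hσ : Function.Involutive σ) :
    involRoot σ * star (involRoot σ) = 1 := by
  rw [star_involRoot hσ, involRoot]
  simp only [add_mul, mul_add, smul_mul_assoc, mul_smul_comm, one_mul, mul_one,
    involMat_mul_self hσ, smul_add, smul_smul]
  have : ∀ a b c e : ℂ, a + e = 1 → b + c = 0 →
      a • (1 : Matrix (Fin n) (Fin n) ℂ) + b • involMat σ + (c • involMat σ + e • 1) = 1 := by
    intro a b c e h1 h2
    rw [show a • (1 : Matrix (Fin n) (Fin n) ℂ) + b • involMat σ + (c • involMat σ + e • 1) =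
      (a + e) • 1 + (b + c) • involMat σ by module, h1, h2]
    simp
  have h1 := complex_coeff_identity
  have h2 := complex_coeff_identity'
  rw [this]
  · linear_combination 2 * h2
  · linear_combination h1

lemma involRoot_mem_unitaryGroup {σ : Fin n → Fin n} (hσ : Function.Involutive σ) :
    involRoot σ ∈ Matrix.unitaryGroup (Fin n) ℂ :=
  Matrix.mem_unitaryGroup_iff.mpr (involRoot_mul_star hσ)

lemma star_involRoot_mul_involMat {σ : Fin n → Fin n} (hσ : Function.Involutive σ) :
    star (involRoot σ) * involMat σ = involRoot σ := by
  rw [star_involRoot hσ, involRoot, add_mul, smul_mul_assoc, smul_mul_assoc,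
    involMat_mul_self hσ, one_mul, add_comm]

lemma involMat_mul_involRoot {σ : Fin n → Fin n} (hσ : Function.Involutive σ) :
    involMat σ * involRoot σ = star (involRoot σ) := by
  rw [star_involRoot hσ, involRoot, mul_add, mul_smul_comm, mul_smul_comm,
    involMat_mul_self hσ, mul_one, add_comm]

/-- If `X` agrees with its conjugate up to the involution, then `P* X P` is a real matrix. -/
lemma conjMat_star_involRoot_mul_mul {σ : Fin n → Fin n} (hσ : Function.Involutive σ)
    {X : Matrix (Fin n) (Fin n) ℂ} (hX : ∀ i j, (starRingEnd ℂ) (X (σ i) (σ j)) = X i j) :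
    conjMat (star (involRoot σ) * X * involRoot σ) = star (involRoot σ) * X * involRoot σ := by
  -- Since `P * P` is the permutation matrix, it is absorbed by `star P` on the left and by `P` on
  -- the right, exchanging each with its conjugate.
  have h : X = involMat σ * conjMat X * involMat σ := by
    ext i j
    rw [mul_involMat_apply hσ, involMat_mul_apply]
    exact (hX i j).symm
  rw [conjMat_mul, conjMat_mul, conjMat_star_involRoot hσ, conjMat_involRoot hσ]
  conv_rhs => rw [h]
  calc involRoot σ * conjMat X * star (involRoot σ)
      = (star (involRoot σ) * involMat σ) * conjMat X * (involMat σ * involRoot σ) := by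
        rw [involMat_mul_involRoot hσ, star_involRoot_mul_involMat hσ]
    _ = _ := by simp only [mul_assoc]

lemma toComplexMat_re {A : Matrix (Fin n) (Fin n) ℂ} (hA : conjMat A = A) :
    toComplexMat (A.map Complex.re) = A := by
  ext i j
  have h : (starRingEnd ℂ) (A i j) = A i j := congrFun (congrFun hA i) j
  exact Complex.conj_eq_iff_re.mp h

end Involution

/-! ### Conjugation to an almost real system by characters and `involRoot`. -/

section Conjugation

variable {d n : ℕ}

lemma sum_smul_single_one_mul (e : Fin n → ℂ) (P : Matrix (Fin n) (Fin n) ℂ) :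
    ∑ i, e i • (Matrix.single i i (1 : ℂ) * P) = Matrix.diagonal e * P := by
  simp only [← smul_mul_assoc, ← Finset.sum_mul]
  congr 1
  ext i j
  rw [Matrix.sum_apply]
  simp only [Matrix.smul_apply, Matrix.single_apply, Matrix.diagonal_apply]
  by_cases h : i = j
  · subst h
    rw [Finset.sum_eq_single i] <;> simp +contextual
  · rw [if_neg h]
    refine Finset.sum_eq_zero fun l _ => ?_
    rw [if_neg, smul_zero]
    rintro ⟨rfl, rfl⟩
    exact h rfl

lemma sum_smul_mul_single_one (e : Fin n → ℂ) (P : Matrix (Fin n) (Fin n) ℂ) :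
    ∑ i, e i • (P * Matrix.single i i (1 : ℂ)) = P * Matrix.diagonal e := by
  have h := sum_smul_single_one_mul e 1
  simp only [mul_one] at h
  rw [← h, Finset.mul_sum]
  simp only [mul_smul_comm]

/-- A partial derivative multiplies each coefficient by at most `2πM`. The hypothesis `hA` bounds
the sum by its largest coefficient, so no factor `n` is lost. -/
lemma cNorm_trigPoly_le (s : ℕ) (m : Fin n → Fin d → ℤ) {M : ℝ}
    (hM1 : 1 ≤ 2 * Real.pi * M) (hM : ∀ i a, |(m i a : ℝ)| ≤ M)
    {A : Fin n → Matrix (Fin n) (Fin n) ℂ}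
    (hA : ∀ e : Fin n → ℂ, ‖∑ i, e i • A i‖ ≤ ‖e‖) :
    cNorm s (trigPoly m A) ≤ (2 * Real.pi * M) ^ s := by
  have h0 : (0 : ℝ) ≤ (2 * Real.pi * M) ^ s := by positivity
  unfold cNorm
  refine Real.iSup_le (fun α => Real.iSup_le (fun θ => ?_) h0) h0
  rw [multiDeriv_trigPoly]
  simp only [trigPoly, smul_smul]
  refine (hA _).trans ((pi_norm_le_iff_of_nonneg h0).mpr fun i => ?_)
  rw [norm_mul, norm_torusChar, one_mul, norm_prod]
  calc ∏ a, ‖charFreq (m i) (Pi.single a 1) ^ α.1 a‖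
      ≤ ∏ a, (2 * Real.pi * M) ^ α.1 a := by
        refine Finset.prod_le_prod (fun a _ => norm_nonneg _) fun a _ => ?_
        rw [norm_pow]
        exact pow_le_pow_left₀ (norm_nonneg _) (norm_charFreq_single_le (hM i a)) _
    _ = (2 * Real.pi * M) ^ ∑ a, α.1 a := Finset.prod_pow_eq_pow_sum _ _ _
    _ ≤ (2 * Real.pi * M) ^ s := pow_le_pow_right₀ hM1 α.2

variable {B : Matrix (Fin n) (Fin n) ℂ}

lemma commute_diagonal_offDiag (hB : IsJordanForm B) {e : Fin n → ℂ}
    (he : ∀ i j : Fin n, (j : ℕ) = i + 1 → jordanLink B i → e i = e j) :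
    Commute (Matrix.diagonal e) (offDiag B) := by
  ext i j
  rw [Matrix.diagonal_mul, Matrix.mul_diagonal, offDiag_apply hB]
  split_ifs with h
  · rw [he i j h.1 h.2, mul_comm]
  · simp

lemma commute_diagonal_diagonal (e f : Fin n → ℂ) :
    Commute (Matrix.diagonal e) (Matrix.diagonal f) := by
  unfold Commute SemiconjBy
  rw [Matrix.diagonal_mul_diagonal, Matrix.diagonal_mul_diagonal]
  simp only [mul_comm]

/-- An involution of the indices matching Jordan blocks whose eigenvalues are conjugate up to a
shift by a frequency gives a conjugation of the system to an almost real one. -/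
lemma exists_conjugation (hn : 1 ≤ n) {N : ℕ} (hN : 1 ≤ N) {ρ : ℝ} (hρ : 0 ≤ ρ)
    (hB : IsJordanForm B) (ω : Fin d → ℝ) {σ : Fin n → Fin n} (hσ : Function.Involutive σ)
    (hσl : ∀ i j : Fin n, (j : ℕ) = i + 1 → jordanLink B i →
      (σ j : ℕ) = σ i + 1 ∧ jordanLink B (σ i))
    {m : Fin n → Fin d → ℤ}
    (hml : ∀ i j : Fin n, (j : ℕ) = i + 1 → jordanLink B i → m i = m j)
    (hmN : ∀ i a, |(m i a : ℝ)| ≤ 2 * n * N)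
    (happ : ∀ i, ‖B i i - (starRingEnd ℂ) (B (σ i) (σ i)) - charFreq (m i) ω‖ ≤ 2 * n * ρ) :
    ∃ (W : (Fin d → ℝ) → Matrix (Fin n) (Fin n) ℂ)
      (B' : Matrix (Fin n) (Fin n) ℝ) (B'' : Matrix (Fin n) (Fin n) ℂ),
      IsTorusFun W ∧
      ContDiff ℝ ((⊤ : ℕ∞) : WithTop ℕ∞) W ∧
      (∀ θ, IsUnit (W θ)) ∧
      (∀ θ, dirDeriv ((1 / 2 : ℝ) • ω) W θ = B * W θ - W θ * (toComplexMat B' + B'')) ∧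
      ‖B''‖ ≤ 2 * (n : ℝ) ^ 2 * ρ ∧
      (∀ s : ℕ, cNorm s W ≤ (2 * Real.pi * n * N) ^ (2 * s) ∧
        cNorm s (fun θ => (W θ)⁻¹) ≤ (2 * Real.pi * n * N) ^ (2 * s)) ∧
      ‖toComplexMat B'‖ ≤ n * ‖B‖ ∧
      ∃ P ∈ Matrix.unitaryGroup (Fin n) ℂ,
        (∀ i j : Fin n, B i i ≠ B j j → (P * toComplexMat B' * star P) i j = 0) ∧
        ∀ θ, Commute (W θ * star P) B ∧
          Commute (W θ * star P) (P * toComplexMat B' * star P) ∧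
          Commute (W θ * star P) (P * B'' * star P) := by
  have hn1 : (1 : ℝ) ≤ n := by exact_mod_cast hn
  have hN1 : (1 : ℝ) ≤ N := by exact_mod_cast hN
  set P := involRoot σ with hPdef
  have hP : P ∈ Matrix.unitaryGroup (Fin n) ℂ := involRoot_mem_unitaryGroup hσ
  have hPP : P * star P = 1 := involRoot_mul_star hσ
  have hPP' : star P * P = 1 := (Matrix.mem_unitaryGroup_iff').mp hP
  have hPn : ‖P‖ ≤ 1 := norm_le_one_of_mem_unitaryGroup hP
  have hPn' : ‖star P‖ ≤ 1 := norm_le_one_of_mem_unitaryGroup (Unitary.star_mem hP)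
  -- the two parts of the conjugated matrix
  let x : Fin n → ℂ := fun i => (B i i + (starRingEnd ℂ) (B (σ i) (σ i))) / 2
  let z : Fin n → ℂ := fun i =>
    (B i i - (starRingEnd ℂ) (B (σ i) (σ i)) - charFreq (m i) ω) / 2
  let X : Matrix (Fin n) (Fin n) ℂ := Matrix.diagonal x + offDiag B
  have hXoff : ∀ i j, i ≠ j → X i j = B i j := fun i j h => by
    simp [X, offDiag, h]
  have hXdiag : ∀ i, X i i = x i := fun i => by simp [X, offDiag]
  have hXconj : ∀ i j, (starRingEnd ℂ) (X (σ i) (σ j)) = X i j := by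
    intro i j
    by_cases hij : i = j
    · subst hij
      rw [hXdiag, hXdiag]
      simp only [x, hσ i, map_div₀, map_add, Complex.conj_conj, map_ofNat]
      ring
    · have hσij : σ i ≠ σ j := fun h => hij (hσ.injective h)
      have e1 : X (σ i) (σ j) = offDiag B (σ i) (σ j) := by simp [X, hσij]
      have e2 : X i j = offDiag B i j := by simp [X, hij]
      have hiff : ((σ j : ℕ) = σ i + 1 ∧ jordanLink B (σ i)) ↔
          ((j : ℕ) = i + 1 ∧ jordanLink B i) := by
        constructor
        · rintro ⟨h1, h2⟩
          have := hσl (σ i) (σ j) h1 h2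
          rwa [hσ, hσ] at this
        · rintro ⟨h1, h2⟩
          exact hσl i j h1 h2
      classical
      rw [e1, e2, offDiag_apply hB, offDiag_apply hB]
      simp only [hiff]
      split_ifs <;> simp
  let A' := star P * X * P
  have hA' : conjMat A' = A' := conjMat_star_involRoot_mul_mul hσ hXconj
  have hconj : ∀ Y : Matrix (Fin n) (Fin n) ℂ, P * (star P * Y * P) * star P = Y := fun Y => by
    calc P * (star P * Y * P) * star P = (P * star P) * Y * (P * star P) := by
          simp only [mul_assoc]
      _ = Y := by rw [hPP, one_mul, mul_one]
  have hnorm : ∀ Y : Matrix (Fin n) (Fin n) ℂ, ‖star P * Y * P‖ ≤ ‖Y‖ := fun Y => by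
    refine (norm_mul_le _ _).trans ?_
    have h1 := norm_mul_le (star P) Y
    nlinarith [norm_nonneg Y, norm_nonneg P, norm_nonneg (star P), norm_nonneg (star P * Y)]
  have hBx : B = X + Matrix.diagonal z + Matrix.diagonal fun i => charFreq (m i) ω / 2 := by
    ext i j
    by_cases hij : i = j
    · subst hij
      simp only [Matrix.add_apply, hXdiag, Matrix.diagonal_apply_eq, x, z]
      ring
    · simp [hXoff i j hij, hij]
  let W := trigPoly m fun i => Matrix.single i i (1 : ℂ) * P
  let W' := trigPoly (fun i => -m i) fun i => star P * Matrix.single i i (1 : ℂ)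
  have hW : ∀ θ, W θ = Matrix.diagonal (fun i => torusChar (m i) θ) * P := fun θ =>
    sum_smul_single_one_mul _ P
  have hW' : ∀ θ, W' θ = star P * Matrix.diagonal (fun i => torusChar (-m i) θ) := fun θ =>
    sum_smul_mul_single_one _ (star P)
  have hWW : ∀ θ, W θ * W' θ = 1 := fun θ => by
    rw [hW, hW']
    calc _ = Matrix.diagonal (fun i => torusChar (m i) θ) * (P * star P) *
          Matrix.diagonal (fun i => torusChar (-m i) θ) := by simp only [mul_assoc]
      _ = 1 := by
        rw [hPP, mul_one, Matrix.diagonal_mul_diagonal]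
        simp only [torusChar_neg_mul, Matrix.diagonal_one]
  have hWinv : (fun θ => (W θ)⁻¹) = W' := funext fun θ => Matrix.inv_eq_right_inv (hWW θ)
  have hWP : ∀ θ, W θ * star P = Matrix.diagonal (fun i => torusChar (m i) θ) := fun θ => by
    rw [hW, mul_assoc, hPP, mul_one]
  have hcoff : ∀ θ, Commute (Matrix.diagonal fun i => torusChar (m i) θ) (offDiag B) := fun θ =>
    commute_diagonal_offDiag hB fun i j h1 h2 => by rw [hml i j h1 h2]
  have hcX : ∀ θ, Commute (Matrix.diagonal fun i => torusChar (m i) θ) X := fun θ =>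
    (commute_diagonal_diagonal _ _).add_right (hcoff θ)
  have hPB' : P * toComplexMat (A'.map Complex.re) * star P = X := by
    rw [toComplexMat_re hA', hconj]
  have hM1 : 1 ≤ 2 * Real.pi * (2 * n * N : ℝ) := by
    have hpi := Real.pi_gt_three
    have : (1 : ℝ) ≤ n * N := one_le_mul_of_one_le_of_one_le hn1 hN1
    nlinarith
  -- Frequencies reach `2nN`; with `y = 2πnN ≥ 2`, the extra factor is absorbed by `2y ≤ y ^ 2`,
  -- whence the exponent `2 * s`.
  have hMpow : ∀ s : ℕ, (2 * Real.pi * (2 * n * N : ℝ)) ^ s ≤ (2 * Real.pi * n * N) ^ (2 * s) := by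
    intro s
    rw [pow_mul]
    refine pow_le_pow_left₀ (by positivity) ?_ s
    have hpi := Real.pi_gt_three
    have : (1 : ℝ) ≤ n * N := one_le_mul_of_one_le_of_one_le hn1 hN1
    have h2 : (2 : ℝ) ≤ 2 * Real.pi * n * N := by nlinarith
    nlinarith
  refine ⟨W, A'.map Complex.re, star P * Matrix.diagonal z * P, isTorusFun_trigPoly _ _,
    contDiff_trigPoly _ _, fun θ => ?_, fun θ => ?_, ?_, fun s => ⟨?_, ?_⟩, ?_, P, hP,
    fun i j hij => ?_, fun θ => ⟨?_, ?_, ?_⟩⟩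
  · exact (Matrix.isUnit_iff_isUnit_det _).mpr
      (Matrix.isUnit_det_of_right_inverse (hWW θ))
  · rw [toComplexMat_re hA', hW]
    have hder : dirDeriv ((1 / 2 : ℝ) • ω) W θ =
        Matrix.diagonal (fun i => torusChar (m i) θ) *
          (Matrix.diagonal fun i => charFreq (m i) ω / 2) * P := by
      simp only [W, dirDeriv_trigPoly, trigPoly, smul_smul]
      rw [sum_smul_single_one_mul, Matrix.diagonal_mul_diagonal]
      simp only [charFreq_smul]
      congr 3
      funext i
      push_cast
      ring
    rw [hder]
    have hDB : Matrix.diagonal (fun i => torusChar (m i) θ) * B =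
        B * Matrix.diagonal (fun i => torusChar (m i) θ) := by
      rw [hBx]
      exact (((hcX θ).add_right (commute_diagonal_diagonal _ _)).add_right
        (commute_diagonal_diagonal _ _)).eq
    have e1 : Matrix.diagonal (fun i => torusChar (m i) θ) * P *
        (A' + star P * Matrix.diagonal z * P) =
        Matrix.diagonal (fun i => torusChar (m i) θ) * (X + Matrix.diagonal z) * P := by
      calc _ = Matrix.diagonal (fun i => torusChar (m i) θ) * (P * star P) *
            (X + Matrix.diagonal z) * P := by simp only [A', mul_add, add_mul, mul_assoc]
        _ = _ := by rw [hPP, mul_one]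
    rw [e1, ← mul_assoc, ← hDB]
    conv_rhs => rw [hBx]
    simp only [mul_add, add_mul, mul_assoc]
    abel
  · refine (hnorm _).trans ?_
    rw [Matrix.l2_opNorm_diagonal]
    have h0 : 0 ≤ 2 * (n : ℝ) ^ 2 * ρ := by positivity
    refine (pi_norm_le_iff_of_nonneg h0).mpr fun i => ?_
    simp only [z, norm_div, Complex.norm_ofNat]
    have := happ i
    have h2 : (n : ℝ) * ρ ≤ n ^ 2 * ρ := by
      rw [sq, mul_assoc]; exact le_mul_of_one_le_left (by positivity) hn1
    have h3 : 0 ≤ (n : ℝ) ^ 2 * ρ := by positivity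
    linarith
  · refine (cNorm_trigPoly_le s m hM1 hmN fun e => ?_).trans (hMpow s)
    rw [sum_smul_single_one_mul]
    refine (norm_mul_le _ _).trans ?_
    rw [Matrix.l2_opNorm_diagonal]
    exact mul_le_of_le_one_right (norm_nonneg _) hPn
  · rw [hWinv]
    refine (cNorm_trigPoly_le s (fun i => -m i) hM1 (fun i a => by simpa using hmN i a)
      fun e => ?_).trans (hMpow s)
    rw [sum_smul_mul_single_one]
    refine (norm_mul_le _ _).trans ?_
    rw [Matrix.l2_opNorm_diagonal]
    exact mul_le_of_le_one_left (norm_nonneg _) hPn'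
  · rw [toComplexMat_re hA']
    refine (hnorm X).trans (l2_opNorm_le_of_entry_le (norm_nonneg _) fun i j => ?_)
    by_cases hij : i = j
    · subst hij
      rw [hXdiag]
      simp only [x, norm_div, Complex.norm_ofNat]
      have h1 := norm_entry_le_l2_opNorm B i i
      have h2 := norm_entry_le_l2_opNorm B (σ i) (σ i)
      have h3 := norm_add_le (B i i) ((starRingEnd ℂ) (B (σ i) (σ i)))
      rw [RCLike.norm_conj] at h3
      linarith
    · rw [hXoff i j hij]
      exact norm_entry_le_l2_opNorm B i j
  · rw [hPB', hXoff i j fun h => hij (by rw [h])]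
    rcases hB i j fun h => hij (by rw [h]) with h | ⟨_, _, h⟩
    · exact h
    · exact absurd h hij
  · rw [hWP]
    rw [hBx]
    exact ((hcX θ).add_right (commute_diagonal_diagonal _ _)).add_right
      (commute_diagonal_diagonal _ _)
  · rw [hWP, hPB']
    exact hcX θ
  · rw [hWP, hconj]
    exact commute_diagonal_diagonal _ _

end Conjugation
end QPCocycle

namespace QPCocycle

/-! ### Eigenvalues conjugate up to frequencies -/

section ConjGraph

variable {d n : ℕ} (B : Matrix (Fin n) (Fin n) ℂ) (ω : Fin d → ℝ) (N : ℕ) (ρ : ℝ)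

/-- The diagonal entries of `B` together with their conjugates. -/
noncomputable def signedEigen (v : Fin n × Bool) : ℂ :=
  if v.2 then (starRingEnd ℂ) (B v.1 v.1) else B v.1 v.1

/-- Two numbers are close up to a frequency of size at most `N * L`, with an error `L * ρ`. -/
def NearModFreq (L : ℕ) (x y : ℂ) : Prop :=
  ∃ k : Fin d → ℤ, (∀ a, |(k a : ℝ)| ≤ L * N) ∧ ‖x - y - charFreq k ω‖ ≤ L * ρ

variable {ω N ρ}

lemma NearModFreq.symm {L : ℕ} {x y : ℂ} (h : NearModFreq ω N ρ L x y) :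
    NearModFreq ω N ρ L y x := by
  obtain ⟨k, h1, h2⟩ := h
  refine ⟨-k, fun a => by simpa using h1 a, ?_⟩
  rw [← norm_neg, charFreq_neg, show -(y - x - -charFreq k ω) = x - y - charFreq k ω by ring]
  exact h2

/-- `charFreq k ω` is purely imaginary, so conjugation replaces `k` by `-k`. -/
lemma NearModFreq.conj {L : ℕ} {x y : ℂ} (h : NearModFreq ω N ρ L x y) :
    NearModFreq ω N ρ L ((starRingEnd ℂ) x) ((starRingEnd ℂ) y) := by
  obtain ⟨k, h1, h2⟩ := h
  refine ⟨-k, fun a => by simpa using h1 a, ?_⟩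
  rw [charFreq_neg, ← conj_charFreq, ← map_sub, ← map_sub, RCLike.norm_conj]
  exact h2

lemma NearModFreq.trans {L L' : ℕ} {x y z : ℂ} (h : NearModFreq ω N ρ L x y)
    (h' : NearModFreq ω N ρ L' y z) : NearModFreq ω N ρ (L + L') x z := by
  obtain ⟨k, h1, h2⟩ := h
  obtain ⟨l, h3, h4⟩ := h'
  refine ⟨k + l, fun a => ?_, ?_⟩
  · simp only [Pi.add_apply, Int.cast_add, Nat.cast_add, add_mul]
    exact (abs_add_le _ _).trans (add_le_add (h1 a) (h3 a))
  · rw [charFreq_add, Nat.cast_add, add_mul]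
    have e : x - z - (charFreq k ω + charFreq l ω) =
        (x - y - charFreq k ω) + (y - z - charFreq l ω) := by ring
    rw [e]
    exact (norm_add_le _ _).trans (add_le_add h2 h4)

lemma NearModFreq.refl (x : ℂ) : NearModFreq ω N ρ 0 x x :=
  ⟨0, fun a => by simp, by simp⟩

lemma NearModFreq.mono (hρ : 0 ≤ ρ) {L L' : ℕ} (hL : L ≤ L') {x y : ℂ}
    (h : NearModFreq ω N ρ L x y) : NearModFreq ω N ρ L' x y := by
  obtain ⟨k, h1, h2⟩ := h
  have hL' : (L : ℝ) ≤ L' := by exact_mod_cast hL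
  exact ⟨k, fun a => (h1 a).trans (by gcongr), h2.trans (by gcongr)⟩

variable (ω N ρ)

/-- The graph joining an eigenvalue to the nearby conjugates of eigenvalues. -/
def conjGraph : SimpleGraph (Fin n × Bool) where
  Adj v w := v.2 ≠ w.2 ∧ NearModFreq ω N ρ 1 (signedEigen B v) (signedEigen B w)
  symm := ⟨fun _ _ h => ⟨h.1.symm, h.2.symm⟩⟩
  loopless := ⟨fun _ h => h.1 rfl⟩

/-- Exchanging eigenvalues and their conjugates is an endomorphism of the graph. -/
def conjGraphSwap : conjGraph B ω N ρ →g conjGraph B ω N ρ where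
  toFun v := (v.1, !v.2)
  map_rel' := by
    rintro ⟨i, a⟩ ⟨j, b⟩ ⟨h1, h2⟩
    refine ⟨by simpa using h1, ?_⟩
    have := h2.conj
    cases a <;> cases b <;> simpa [signedEigen] using this

variable {B ω N ρ}

lemma nearModFreq_of_walk {v w : Fin n × Bool} (p : (conjGraph B ω N ρ).Walk v w) :
    NearModFreq ω N ρ p.length (signedEigen B v) (signedEigen B w) := by
  induction p with
  | nil => exact NearModFreq.refl _
  | cons h p ih =>
    rw [SimpleGraph.Walk.length_cons, add_comm]
    exact h.2.trans ih

/-- Frequencies and errors add along a walk, and a path visits each of the `2 * n` vertices at most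
once. -/
lemma nearModFreq_of_reachable (hρ : 0 ≤ ρ) {v w : Fin n × Bool}
    (h : (conjGraph B ω N ρ).Reachable v w) :
    NearModFreq ω N ρ (2 * n) (signedEigen B v) (signedEigen B w) := by
  classical
  obtain ⟨p⟩ := h
  refine (nearModFreq_of_walk p.toPath.1).mono hρ ?_
  have := p.toPath.2.length_lt
  simp only [Fintype.card_prod, Fintype.card_fin, Fintype.card_bool] at this
  omega

/-- An approximate intertwiner supported on pairs of eigenvalues conjugate up to a frequency
provides a compatible involution of the Jordan blocks. -/
lemma exists_involution_and_shift (hn : 0 < n) (hρ : 0 ≤ ρ) (hB : IsJordanForm B)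
    {V Y : Matrix (Fin n) (Fin n) ℂ} {η γ u : ℝ}
    (hV : ∀ i j, V i j ≠ 0 → NearModFreq ω N ρ 1 (B i i) ((starRingEnd ℂ) (B j j)))
    (hη : ∀ i j, ‖(1 - V * Y) i j‖ ≤ η)
    (hγ : ∀ i j, ‖(offDiag B * V - V * offDiag B) i j‖ ≤ γ)
    (hu : ∀ i j, ‖Y i j‖ ≤ u)
    (hsmall : n * η + n ^ 2 * (2 * n) ^ n * (γ * u) < 1) :
    ∃ (σ : Fin n → Fin n) (m : Fin n → Fin d → ℤ), Function.Involutive σ ∧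
      (∀ i j : Fin n, (j : ℕ) = i + 1 → jordanLink B i →
        (σ j : ℕ) = σ i + 1 ∧ jordanLink B (σ i)) ∧
      (∀ i j : Fin n, (j : ℕ) = i + 1 → jordanLink B i → m i = m j) ∧
      (∀ i a, |(m i a : ℝ)| ≤ 2 * n * N) ∧
      (∀ i, ‖B i i - (starRingEnd ℂ) (B (σ i) (σ i)) - charFreq (m i) ω‖ ≤ 2 * n * ρ) := by
  classical
  set Γ := conjGraph B ω N ρ
  let key : Fin n → Γ.ConnectedComponent := fun i => Γ.connectedComponentMk (i, false)
  let st : Γ.ConnectedComponent → Γ.ConnectedComponent :=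
    SimpleGraph.ConnectedComponent.map (conjGraphSwap B ω N ρ)
  have hst' : ∀ i b, st (Γ.connectedComponentMk (i, b)) = Γ.connectedComponentMk (i, !b) :=
    fun i b => rfl
  have hst : Function.Involutive st := by
    intro c
    induction c using SimpleGraph.ConnectedComponent.ind with
    | h v => obtain ⟨i, b⟩ := v; rw [hst', hst', Bool.not_not]
  have hVadj : ∀ i j, V i j ≠ 0 → Γ.Adj (i, false) (j, true) := fun i j h =>
    ⟨by simp, by simpa [signedEigen] using hV i j h⟩
  have hVkey : ∀ i j, V i j ≠ 0 → key j = st (key i) := by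
    intro i j h
    have h1 : key i = Γ.connectedComponentMk (j, true) :=
      SimpleGraph.ConnectedComponent.sound (hVadj i j h).reachable
    rw [h1, hst']
    rfl
  have hη0 : 0 ≤ η := (norm_nonneg _).trans (hη ⟨0, hn⟩ ⟨0, hn⟩)
  have hη1 : η < 1 := by
    have hγ0 := (norm_nonneg _).trans (hγ ⟨0, hn⟩ ⟨0, hn⟩)
    have hu0 := (norm_nonneg _).trans (hu ⟨0, hn⟩ ⟨0, hn⟩)
    have h1 : 0 ≤ (n : ℝ) ^ 2 * (2 * n) ^ n * (γ * u) := by positivity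
    have h2 : (1 : ℝ) ≤ n := by exact_mod_cast hn
    nlinarith
  -- A zero row of `V` would give a diagonal entry `1` of `1 - V * Y`, although `η < 1`.
  have hrow : ∀ i, ∃ j, V i j ≠ 0 := by
    intro i
    by_contra hc
    push Not at hc
    have h1 : (V * Y) i i = 0 := by
      rw [Matrix.mul_apply]
      exact Finset.sum_eq_zero fun j _ => by rw [hc j, zero_mul]
    have h2 := hη i i
    rw [Matrix.sub_apply, h1, Matrix.one_apply_eq, sub_zero, norm_one] at h2
    linarith
  -- Vertices are indices, not eigenvalues, so equal eigenvalues are not joined directly; they share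
  -- a neighbour, supplied by a non-zero entry in row `i`.
  have hkey : ∀ i j : Fin n, (j : ℕ) = i + 1 → jordanLink B i → key i = key j := by
    intro i j hij hl
    obtain ⟨l, hl'⟩ := hrow i
    have h1 := hVadj i l hl'
    have h2 : Γ.Adj (j, false) (l, true) := by
      refine ⟨by simp, ?_⟩
      have := h1.2
      simp only [signedEigen, jordanLink_diag hB hij hl] at this ⊢
      exact this
    exact SimpleGraph.ConnectedComponent.sound (h1.reachable.trans h2.symm.reachable)
  obtain ⟨σ, hσ, hσkey, hσl⟩ := exists_jordan_involution hn hB hst hkey hVkey hη hγ hu hsmall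
  have hnear : ∀ i, NearModFreq ω N ρ (2 * n) (B i i) ((starRingEnd ℂ) (B (σ i) (σ i))) := by
    intro i
    have h1 : Γ.connectedComponentMk (i, false) = Γ.connectedComponentMk (σ i, true) := by
      have h2 : st (key (σ i)) = key i := by rw [hσkey, hst]
      exact h2.symm
    have h3 := nearModFreq_of_reachable hρ (SimpleGraph.ConnectedComponent.exact h1)
    simpa [signedEigen] using h3
  -- The predicate depends on `i` only through `B i i` and `B (σ i) (σ i)`, so linked indices
  -- receive the same frequency vector. A choice made separately for each `i` would not ensure this,
  -- and `D` would then fail to commute with the nilpotent part.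
  let m : Fin n → Fin d → ℤ := fun i => Classical.epsilon fun k : Fin d → ℤ =>
    (∀ a, |(k a : ℝ)| ≤ (2 * n : ℕ) * N) ∧
      ‖B i i - (starRingEnd ℂ) (B (σ i) (σ i)) - charFreq k ω‖ ≤ (2 * n : ℕ) * ρ
  have hm : ∀ i, (∀ a, |(m i a : ℝ)| ≤ (2 * n : ℕ) * N) ∧
      ‖B i i - (starRingEnd ℂ) (B (σ i) (σ i)) - charFreq (m i) ω‖ ≤ (2 * n : ℕ) * ρ :=
    fun i => Classical.epsilon_spec (hnear i)
  refine ⟨σ, m, hσ, hσl, fun i j hij hl => ?_, fun i => ?_, fun i => ?_⟩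
  · obtain ⟨h1, h2⟩ := hσl i j hij hl
    simp only [m, jordanLink_diag hB hij hl, jordanLink_diag hB h1 h2]
  · simpa only [Nat.cast_mul, Nat.cast_ofNat] using (hm i).1
  · simpa only [Nat.cast_mul, Nat.cast_ofNat] using (hm i).2

end ConjGraph
end QPCocycle

namespace QPCocycle

/-! ### Fourier coefficients of functions on the torus -/

section Fourier

open MeasureTheory UnitAddTorus

/-- The measure on the circle is normalised to total mass one. -/
noncomputable local instance circleMeasureSpace : MeasureSpace UnitAddCircle :=
  ⟨AddCircle.haarAddCircle⟩

local instance : Measure.IsAddHaarMeasure (volume : Measure UnitAddCircle) :=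
  inferInstanceAs (Measure.IsAddHaarMeasure AddCircle.haarAddCircle)

local instance : IsProbabilityMeasure (volume : Measure UnitAddCircle) :=
  inferInstanceAs (IsProbabilityMeasure AddCircle.haarAddCircle)

variable {d : ℕ} {E : Type*}

/-- The projection of `ℝ^d` to the torus. -/
def torusMk (θ : Fin d → ℝ) : UnitAddTorus (Fin d) := fun i => (θ i : UnitAddCircle)

lemma torusMk_surjective : Function.Surjective (torusMk (d := d)) := fun x =>
  ⟨fun i => (QuotientAddGroup.mk_surjective (x i)).choose,
    funext fun i => (QuotientAddGroup.mk_surjective (x i)).choose_spec⟩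

lemma torusMk_add (θ φ : Fin d → ℝ) : torusMk (θ + φ) = torusMk θ + torusMk φ := rfl

lemma isOpenQuotientMap_torusMk : IsOpenQuotientMap (torusMk (d := d)) :=
  IsOpenQuotientMap.piMap fun _ => QuotientAddGroup.isOpenQuotientMap_mk

/-- The function on the torus induced by a periodic function. -/
noncomputable def torusLift (f : (Fin d → ℝ) → E) (x : UnitAddTorus (Fin d)) : E :=
  f (torusMk_surjective x).choose

lemma torusLift_mk {f : (Fin d → ℝ) → E} (hf : IsTorusFun f) (θ : Fin d → ℝ) :
    torusLift f (torusMk θ) = f θ := by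
  have h := (torusMk_surjective (torusMk θ)).choose_spec
  set φ := (torusMk_surjective (torusMk θ)).choose with hφ
  have h1 : ∀ i, ∃ k : ℤ, φ i = θ i + k := by
    intro i
    have h2 : (φ i : UnitAddCircle) = (θ i : UnitAddCircle) := congrFun h i
    obtain ⟨k, hk⟩ := AddSubgroup.mem_zmultiples_iff.mp (QuotientAddGroup.eq.mp h2)
    refine ⟨-k, ?_⟩
    simp only [zsmul_eq_mul, mul_one] at hk
    push_cast
    linarith
  choose k hk using h1
  change f φ = f θ
  rw [← hf θ k]
  congr 1
  exact funext hk

lemma continuous_torusLift [TopologicalSpace E] {f : (Fin d → ℝ) → E} (hf : IsTorusFun f)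
    (hc : Continuous f) : Continuous (torusLift f) := by
  rw [isOpenQuotientMap_torusMk.isQuotientMap.continuous_iff]
  exact hc.congr fun θ => (torusLift_mk hf θ).symm

lemma exists_norm_le_of_isTorusFun [NormedAddCommGroup E] {f : (Fin d → ℝ) → E}
    (hf : IsTorusFun f) (hc : Continuous f) : ∃ C, ∀ θ, ‖f θ‖ ≤ C := by
  obtain ⟨C, hC⟩ := (isCompact_range (continuous_torusLift hf hc)).isBounded.exists_norm_le
  exact ⟨C, fun θ => hC _ ⟨torusMk θ, torusLift_mk hf θ⟩⟩

lemma mFourier_torusMk (k : Fin d → ℤ) (θ : Fin d → ℝ) :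
    mFourier k (torusMk θ) = torusChar k θ := by
  change ∏ i, fourier (k i) (θ i : UnitAddCircle) = _
  simp only [fourier_coe_apply, torusChar]
  rw [← Complex.exp_sum, Finset.mul_sum]
  congr 1
  exact Finset.sum_congr rfl fun i _ => by push_cast; ring

/-- The Fourier coefficients of a periodic function. -/
noncomputable def torusCoeff (f : (Fin d → ℝ) → ℂ) (k : Fin d → ℤ) : ℂ :=
  mFourierCoeff (torusLift f) k

/-- The mean square of a periodic function. -/
noncomputable def meanSq (f : (Fin d → ℝ) → ℂ) : ℝ := ∫ x, ‖torusLift f x‖ ^ 2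

lemma torusCoeff_eq (f : (Fin d → ℝ) → ℂ) (k : Fin d → ℤ) :
    torusCoeff f k = ∫ x, mFourier (-k) x * torusLift f x := rfl

lemma integrable_of_continuous_torus {F : Type*} [NormedAddCommGroup F]
    {f : UnitAddTorus (Fin d) → F} (hf : Continuous f) : Integrable f :=
  hf.integrable_of_hasCompactSupport (HasCompactSupport.of_compactSpace f)

lemma hasSum_sq_torusCoeff {f : (Fin d → ℝ) → ℂ} (hf : IsTorusFun f) (hc : Continuous f) :
    HasSum (fun k => ‖torusCoeff f k‖ ^ 2) (meanSq f) := by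
  let F : C(UnitAddTorus (Fin d), ℂ) := ⟨torusLift f, continuous_torusLift hf hc⟩
  have h := hasSum_sq_mFourierCoeff (ContinuousMap.toLp 2 volume ℂ F)
  simp only [mFourierCoeff_toLp] at h
  have h2 : ∫ t, ‖(ContinuousMap.toLp (E := ℂ) 2 volume ℂ F) t‖ ^ 2 = meanSq f := by
    apply integral_congr_ae
    filter_upwards [ContinuousMap.coeFn_toLp (p := 2) (𝕜 := ℂ) volume F] with x hx
    rw [hx]
    rfl
  rw [h2] at h
  exact h

lemma meanSq_le {f : (Fin d → ℝ) → ℂ} {c : ℝ} (hf : IsTorusFun f) (hc : Continuous f)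
    (h : ∀ θ, ‖f θ‖ ≤ c) : meanSq f ≤ c ^ 2 := by
  have h1 : meanSq f ≤ ∫ _x : UnitAddTorus (Fin d), c ^ 2 := by
    refine integral_mono (integrable_of_continuous_torus
      ((continuous_torusLift hf hc).norm.pow 2)) (integrable_const _) fun x => ?_
    exact pow_le_pow_left₀ (norm_nonneg _) (h _) 2
  simpa using h1

/-- The torus has total mass one, so a continuous function is somewhere at most its integral.
Summing before averaging yields one point for all the functions. -/
lemma exists_sum_sq_le_sum_meanSq {ι : Type*} [Fintype ι] {f : ι → (Fin d → ℝ) → ℂ}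
    (hf : ∀ i, IsTorusFun (f i)) (hc : ∀ i, Continuous (f i)) :
    ∃ θ, ∑ i, ‖f i θ‖ ^ 2 ≤ ∑ i, meanSq (f i) := by
  have hint : ∀ i, Integrable (fun x => ‖torusLift (f i) x‖ ^ 2) := fun i =>
    integrable_of_continuous_torus ((continuous_torusLift (hf i) (hc i)).norm.pow 2)
  obtain ⟨x, hx⟩ := exists_le_integral (μ := (volume : Measure (UnitAddTorus (Fin d))))
    (integrable_finsetSum Finset.univ fun i _ => hint i)
  rw [integral_finsetSum _ fun i _ => hint i] at hx
  exact ⟨_, hx⟩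

lemma torusCoeff_const_mul (c : ℂ) (f : (Fin d → ℝ) → ℂ) (k : Fin d → ℤ) :
    torusCoeff (fun θ => c * f θ) k = c * torusCoeff f k := by
  simp only [torusCoeff_eq]
  rw [← integral_const_mul]
  refine integral_congr_ae (.of_forall fun x => ?_)
  simp only [torusLift]
  ring

lemma integrable_mFourier_mul {f : (Fin d → ℝ) → ℂ} (hf : IsTorusFun f) (hc : Continuous f)
    (k : Fin d → ℤ) : Integrable fun x => mFourier k x * torusLift f x :=
  integrable_of_continuous_torus ((mFourier k).continuous.mul (continuous_torusLift hf hc))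

lemma torusCoeff_add {f g : (Fin d → ℝ) → ℂ} (hf : IsTorusFun f) (hfc : Continuous f)
    (hg : IsTorusFun g) (hgc : Continuous g) (k : Fin d → ℤ) :
    torusCoeff (fun θ => f θ + g θ) k = torusCoeff f k + torusCoeff g k := by
  simp only [torusCoeff_eq]
  rw [← integral_add (integrable_mFourier_mul hf hfc _) (integrable_mFourier_mul hg hgc _)]
  refine integral_congr_ae (.of_forall fun x => ?_)
  simp only [torusLift]
  ring

lemma torusCoeff_sub {f g : (Fin d → ℝ) → ℂ} (hf : IsTorusFun f) (hfc : Continuous f)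
    (hg : IsTorusFun g) (hgc : Continuous g) (k : Fin d → ℤ) :
    torusCoeff (fun θ => f θ - g θ) k = torusCoeff f k - torusCoeff g k := by
  simp only [torusCoeff_eq]
  rw [← integral_sub (integrable_mFourier_mul hf hfc _) (integrable_mFourier_mul hg hgc _)]
  refine integral_congr_ae (.of_forall fun x => ?_)
  simp only [torusLift]
  ring

lemma torusCoeff_sum {ι : Type*} (s : Finset ι) (c : ι → ℂ) {f : ι → (Fin d → ℝ) → ℂ}
    (hf : ∀ i ∈ s, IsTorusFun (f i)) (hc : ∀ i ∈ s, Continuous (f i)) (k : Fin d → ℤ) :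
    torusCoeff (fun θ => ∑ i ∈ s, c i * f i θ) k = ∑ i ∈ s, c i * torusCoeff (f i) k := by
  simp only [← torusCoeff_const_mul]
  simp only [torusCoeff_eq]
  rw [← integral_finsetSum]
  · refine integral_congr_ae (.of_forall fun x => ?_)
    simp only [torusLift, Finset.mul_sum]
  · intro i hi
    refine integrable_mFourier_mul (fun θ l => ?_) (continuous_const.mul (hc i hi)) _
    change c i * f i _ = c i * f i θ
    rw [hf i hi θ l]

lemma torusCoeff_torusChar [DecidableEq (Fin d → ℤ)] (k l : Fin d → ℤ) :
    torusCoeff (torusChar l) k = if l = k then 1 else 0 := by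
  have h := (orthonormal_iff_ite.mp (orthonormal_mFourier (d := Fin d))) k l
  rw [ContinuousMap.inner_toLp] at h
  have h2 : torusCoeff (torusChar l) k = ∫ x, mFourier l x * (starRingEnd ℂ) (mFourier k x) := by
    rw [torusCoeff_eq]
    refine integral_congr_ae (.of_forall fun x => ?_)
    obtain ⟨θ, rfl⟩ := torusMk_surjective x
    beta_reduce
    rw [mFourier_neg, torusLift_mk (isTorusFun_torusChar l), mFourier_torusMk, mFourier_torusMk,
      mul_comm]
  rw [h2, h]
  simp only [eq_comm]

lemma isTorusFun_dirDeriv [NormedAddCommGroup E] [NormedSpace ℝ E] {f : (Fin d → ℝ) → E}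
    (hf : IsTorusFun f) (v : Fin d → ℝ) : IsTorusFun (dirDeriv v f) := by
  intro θ k
  simp only [dirDeriv, lineDeriv]
  congr 1
  funext t
  rw [add_right_comm, hf]

lemma hasDerivAt_dirDeriv [NormedAddCommGroup E] [NormedSpace ℝ E] {f : (Fin d → ℝ) → E}
    (hc : Differentiable ℝ f) (v θ : Fin d → ℝ) (t : ℝ) :
    HasDerivAt (fun t : ℝ => f (θ + t • v)) (dirDeriv v f (θ + t • v)) t := by
  have h1 : dirDeriv v f (θ + t • v) = fderiv ℝ f (θ + t • v) v :=
    (hc _).lineDeriv_eq_fderiv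
  rw [h1]
  have h2 : HasDerivAt (fun t : ℝ => θ + t • v) v t := by
    simpa using ((hasDerivAt_id t).smul_const v).const_add θ
  exact (hc (θ + t • v)).hasFDerivAt.comp_hasDerivAt t h2

lemma continuous_dirDeriv [NormedAddCommGroup E] [NormedSpace ℝ E] {f : (Fin d → ℝ) → E}
    (hc : ContDiff ℝ 1 f) (v : Fin d → ℝ) : Continuous (dirDeriv v f) := by
  have h1 : dirDeriv v f = fun θ => fderiv ℝ f θ v := funext fun θ =>
    (hc.differentiable one_ne_zero θ).lineDeriv_eq_fderiv
  rw [h1]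
  exact (hc.continuous_fderiv one_ne_zero).clm_apply continuous_const

/-- The coefficient of the translate of `f` by `t • v` is differentiated at `t = 0` in two ways:
under the integral, and after translation invariance has turned it into `exp (t * charFreq k v)`
times the coefficient of `f`. This works for any real direction `v`. -/
lemma torusCoeff_dirDeriv {f : (Fin d → ℝ) → ℂ} (hf : IsTorusFun f) (hc : ContDiff ℝ 1 f)
    (v : Fin d → ℝ) (k : Fin d → ℤ) :
    torusCoeff (dirDeriv v f) k = charFreq k v * torusCoeff f k := by
  have hline := hasDerivAt_dirDeriv (hc.differentiable one_ne_zero) v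
  have hper := isTorusFun_dirDeriv hf v
  have hcont := continuous_dirDeriv hc v
  have h0 : torusMk ((0 : ℝ) • v) = 0 := by rw [zero_smul]; rfl
  obtain ⟨C, hC⟩ := exists_norm_le_of_isTorusFun hper hcont
  let g : ℝ → ℂ := fun t => ∫ x, mFourier (-k) x * torusLift f (x + torusMk (t • v))
  have hg1 : ∀ t, g t = Complex.exp (t * charFreq k v) * torusCoeff f k := by
    intro t
    rw [torusCoeff_eq, ← integral_const_mul]
    rw [← integral_add_right_eq_self _ (torusMk (t • v))]
    refine integral_congr_ae (.of_forall fun x => ?_)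
    obtain ⟨θ, rfl⟩ := torusMk_surjective x
    simp only [← torusMk_add, torusLift_mk hf, mFourier_torusMk, torusChar_add_smul, charFreq_neg]
    rw [← mul_assoc]
    congr 1
    rw [mul_left_comm, ← Complex.exp_add]
    simp
  have hF : ∀ t : ℝ, Continuous fun x => mFourier (-k) x * torusLift f (x + torusMk (t • v)) :=
    fun t => (mFourier (-k)).continuous.mul
      ((continuous_torusLift hf hc.continuous).comp (continuous_id.add continuous_const))
  have hF' : Continuous fun x => mFourier (-k) x * torusLift (dirDeriv v f) x :=
    (mFourier (-k)).continuous.mul (continuous_torusLift hper hcont)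
  have hg2 : HasDerivAt g (torusCoeff (dirDeriv v f) k) 0 := by
    have := (hasDerivAt_integral_of_dominated_loc_of_deriv_le
      (μ := (volume : Measure (UnitAddTorus (Fin d)))) (bound := fun _ => C) (x₀ := (0 : ℝ))
      (F := fun t x => mFourier (-k) x * torusLift f (x + torusMk (t • v)))
      (F' := fun t x => mFourier (-k) x * torusLift (dirDeriv v f) (x + torusMk (t • v)))
      (s := Set.univ) Filter.univ_mem
      (.of_forall fun t => (hF t).aestronglyMeasurable)
      (integrable_of_continuous_torus (hF 0))
      (by simpa only [h0, add_zero] using hF'.aestronglyMeasurable)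
      (.of_forall fun x t _ => by
        obtain ⟨θ, rfl⟩ := torusMk_surjective x
        rw [norm_mul, mFourier_torusMk, norm_torusChar, one_mul]
        exact hC _)
      (integrable_const _)
      (.of_forall fun x t _ => by
        obtain ⟨θ, rfl⟩ := torusMk_surjective x
        simp only [← torusMk_add, torusLift_mk hf, torusLift_mk hper]
        exact (hline θ t).const_mul _)).2
    simp only [h0, add_zero] at this
    exact this
  have hg3 : HasDerivAt g (charFreq k v * torusCoeff f k) 0 := by
    rw [funext hg1]
    have h1 : HasDerivAt (fun t : ℝ => (t : ℂ) * charFreq k v) (charFreq k v) 0 := by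
      simpa using (Complex.ofRealCLM.hasDerivAt (x := (0 : ℝ))).mul_const (charFreq k v)
    simpa using h1.cexp.mul_const (torusCoeff f k)
  exact hg2.unique hg3

end Fourier
end QPCocycle

namespace QPCocycle

/-! ### Bounds by the `C^r` norm -/

section CNormBounds

variable {d : ℕ} {E : Type*} [NormedAddCommGroup E] [NormedSpace ℝ E]

instance finite_multiIndex (r : ℕ) : Finite {α : Fin d → ℕ // ∑ i, α i ≤ r} := by
  refine Set.Finite.subset (Set.finite_Iic (fun _ : Fin d => r)) fun α hα i => ?_
  exact (Finset.single_le_sum (f := α) (fun _ _ => Nat.zero_le _) (Finset.mem_univ i)).trans hα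

lemma norm_multiDeriv_le_cNorm {r : ℕ} {f : (Fin d → ℝ) → E} {α : Fin d → ℕ}
    (hα : ∑ i, α i ≤ r) (hper : IsTorusFun (multiDeriv α f)) (hc : Continuous (multiDeriv α f))
    (θ : Fin d → ℝ) : ‖multiDeriv α f θ‖ ≤ cNorm r f := by
  obtain ⟨C, hC⟩ := exists_norm_le_of_isTorusFun hper hc
  refine (le_ciSup (f := fun θ => ‖multiDeriv α f θ‖) ⟨C, ?_⟩ θ).trans ?_
  · rintro _ ⟨θ, rfl⟩
    exact hC θ
  · exact le_ciSup (f := fun α : {α : Fin d → ℕ // ∑ i, α i ≤ r} =>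
      ⨆ θ : Fin d → ℝ, ‖multiDeriv α.1 f θ‖) (Set.finite_range _).bddAbove ⟨α, hα⟩

lemma multiDeriv_zero (f : (Fin d → ℝ) → E) : multiDeriv 0 f = f := by
  unfold multiDeriv
  induction List.finRange d with
  | nil => rfl
  | cons a l ih => rw [List.foldr_cons, ih]; rfl

lemma multiDeriv_single (a : Fin d) (f : (Fin d → ℝ) → E) :
    multiDeriv (Pi.single a 1) f = dirDeriv (Pi.single a (1 : ℝ)) f := by
  have h1 : ∀ l : List (Fin d), a ∉ l → l.foldr (fun i g =>
      (dirDeriv (Pi.single i (1 : ℝ)))^[(Pi.single a 1 : Fin d → ℕ) i] g) f = f := by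
    intro l
    induction l with
    | nil => intro _; rfl
    | cons b l ih =>
      intro h
      rw [List.mem_cons, not_or] at h
      rw [List.foldr_cons, ih h.2, Pi.single_eq_of_ne (Ne.symm h.1)]
      rfl
  have h2 : ∀ l : List (Fin d), l.Nodup → a ∈ l → l.foldr (fun i g =>
      (dirDeriv (Pi.single i (1 : ℝ)))^[(Pi.single a 1 : Fin d → ℕ) i] g) f =
        dirDeriv (Pi.single a (1 : ℝ)) f := by
    intro l
    induction l with
    | nil => intro _ h; simp at h
    | cons b l ih =>
      intro hnd h
      rw [List.nodup_cons] at hnd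
      rw [List.foldr_cons]
      by_cases hb : a = b
      · subst hb
        rw [h1 l hnd.1, Pi.single_eq_same]
        rfl
      · rw [ih hnd.2 ((List.mem_cons.mp h).resolve_left hb), Pi.single_eq_of_ne (Ne.symm hb)]
        rfl
  exact h2 _ (List.nodup_finRange d) (List.mem_finRange a)

lemma norm_le_cNorm (r : ℕ) {f : (Fin d → ℝ) → E} (hf : IsTorusFun f) (hc : Continuous f)
    (θ : Fin d → ℝ) : ‖f θ‖ ≤ cNorm r f := by
  have := norm_multiDeriv_le_cNorm (r := r) (f := f) (α := 0) (by simp)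
    (by rwa [multiDeriv_zero]) (by rwa [multiDeriv_zero]) θ
  rwa [multiDeriv_zero] at this

lemma norm_dirDeriv_single_le_cNorm {r : ℕ} (hr : 1 ≤ r) {f : (Fin d → ℝ) → E}
    (hf : IsTorusFun f) (hc : ContDiff ℝ 1 f) (a : Fin d) (θ : Fin d → ℝ) :
    ‖dirDeriv (Pi.single a (1 : ℝ)) f θ‖ ≤ cNorm r f := by
  have := norm_multiDeriv_le_cNorm (r := r) (f := f) (α := Pi.single a 1)
    (by rw [Finset.sum_pi_single']; simpa using hr)
    (by rw [multiDeriv_single]; exact isTorusFun_dirDeriv hf _)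
    (by rw [multiDeriv_single]; exact continuous_dirDeriv hc _) θ
  rwa [multiDeriv_single] at this

end CNormBounds

/-! ### Entries of matrix-valued functions -/

section Entries

variable {d n : ℕ}

/-- The entry of a matrix as a continuous linear map. -/
noncomputable def entryCLM (i j : Fin n) : Matrix (Fin n) (Fin n) ℂ →L[ℝ] ℂ :=
  LinearMap.mkContinuous
    { toFun := fun A => A i j, map_add' := fun _ _ => rfl, map_smul' := fun _ _ => rfl } 1
    fun A => by rw [one_mul]; exact norm_entry_le_l2_opNorm A i j

lemma contDiff_entry {r : WithTop ℕ∞} {F : (Fin d → ℝ) → Matrix (Fin n) (Fin n) ℂ}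
    (h : ContDiff ℝ r F) (i j : Fin n) : ContDiff ℝ r fun θ => F θ i j :=
  (entryCLM i j).contDiff.comp h

lemma continuous_entry {F : (Fin d → ℝ) → Matrix (Fin n) (Fin n) ℂ}
    (h : Continuous F) (i j : Fin n) : Continuous fun θ => F θ i j :=
  (entryCLM i j).continuous.comp h

lemma isTorusFun_entry {F : (Fin d → ℝ) → Matrix (Fin n) (Fin n) ℂ}
    (h : IsTorusFun F) (i j : Fin n) : IsTorusFun fun θ => F θ i j := fun θ k => by
  simp only [h θ k]

lemma dirDeriv_entry {F : (Fin d → ℝ) → Matrix (Fin n) (Fin n) ℂ} (h : Differentiable ℝ F)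
    (v : Fin d → ℝ) (i j : Fin n) (θ : Fin d → ℝ) :
    dirDeriv v (fun θ => F θ i j) θ = dirDeriv v F θ i j := by
  have h1 := hasDerivAt_dirDeriv h v θ 0
  simp only [zero_smul, add_zero] at h1
  have h2 : HasDerivAt (fun t : ℝ => entryCLM i j (F (θ + t • v)))
      (entryCLM i j (dirDeriv v F θ)) 0 := (entryCLM i j).hasFDerivAt.comp_hasDerivAt 0 h1
  exact h2.deriv

end Entries

/-! ### Fourier coefficients of an approximate conjugation -/

section Sylvester

variable {n : ℕ} {B : Matrix (Fin n) (Fin n) ℂ}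

/-- The off-diagonal entries are `0` or `1`, so conjugation only affects the eigenvalues, and the
same nilpotent matrix acts on both sides of the Sylvester equation. -/
lemma conjMat_eq_diagonal_add_offDiag (hB : IsJordanForm B) :
    conjMat B = Matrix.diagonal (fun i => (starRingEnd ℂ) (B i i)) + offDiag B := by
  classical
  conv_lhs => rw [← diagonal_add_offDiag B]
  ext i j
  simp only [conjMat, Matrix.map_apply, Matrix.add_apply, map_add]
  congr 1
  · by_cases h : i = j
    · subst h; simp
    · simp [h]
  · rw [offDiag_apply hB]
    split_ifs <;> simp

/-- A row of the nilpotent part has at most one non-zero entry, so no factor `n` appears. -/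
lemma norm_offDiag_mul_apply_le (hB : IsJordanForm B) {X : Matrix (Fin n) (Fin n) ℂ} {i j : Fin n}
    {c : ℝ} (hc : 0 ≤ c) (h : ∀ l : Fin n, (l : ℕ) = i + 1 → jordanLink B i → ‖X l j‖ ≤ c) :
    ‖(offDiag B * X) i j‖ ≤ c := by
  classical
  rw [Matrix.mul_apply]
  simp_rw [offDiag_apply hB]
  by_cases hi : ∃ l : Fin n, (l : ℕ) = i + 1 ∧ jordanLink B i
  · obtain ⟨l, h1, h2⟩ := hi
    rw [Finset.sum_eq_single l]
    · rw [if_pos ⟨h1, h2⟩, one_mul]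
      exact h l h1 h2
    · intro b _ hb
      rw [if_neg fun h => hb (Fin.ext (by omega)), zero_mul]
    · simp
  · rw [Finset.sum_eq_zero]
    · simpa using hc
    · intro l _
      rw [if_neg fun h => hi ⟨l, h⟩, zero_mul]

lemma norm_mul_offDiag_apply_le (hB : IsJordanForm B) {X : Matrix (Fin n) (Fin n) ℂ} {i j : Fin n}
    {c : ℝ} (hc : 0 ≤ c) (h : ∀ l : Fin n, (j : ℕ) = l + 1 → jordanLink B l → ‖X i l‖ ≤ c) :
    ‖(X * offDiag B) i j‖ ≤ c := by
  classical
  rw [Matrix.mul_apply]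
  simp_rw [offDiag_apply hB]
  by_cases hi : ∃ l : Fin n, (j : ℕ) = l + 1 ∧ jordanLink B l
  · obtain ⟨l, h1, h2⟩ := hi
    rw [Finset.sum_eq_single l]
    · rw [if_pos ⟨h1, h2⟩, mul_one]
      exact h l h1 h2
    · intro b _ hb
      rw [if_neg fun h => hb (Fin.ext (by omega)), mul_zero]
    · simp
  · rw [Finset.sum_eq_zero]
    · simpa using hc
    · intro l _
      rw [if_neg fun h => hi ⟨l, h⟩, mul_zero]

/-- Bound of the entries of the solution of a Sylvester equation away from resonances. -/
lemma norm_sylvester_le (hB : IsJordanForm B) {X Γ : Matrix (Fin n) (Fin n) ℂ} {μ : ℂ} {ρ q : ℝ}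
    (hρ : 0 < ρ) (hρ1 : ρ ≤ 1) (hq : ∀ i j, ‖Γ i j‖ ≤ q)
    (heq : ∀ i j, (B i i - (starRingEnd ℂ) (B j j) - μ) * X i j =
      -Γ i j - (offDiag B * X) i j + (X * offDiag B) i j) (h : ℕ) :
    ∀ i j : Fin n, n - 1 - (i : ℕ) + j = h → ρ < ‖B i i - (starRingEnd ℂ) (B j j) - μ‖ →
      ‖X i j‖ ≤ 3 ^ h * (ρ⁻¹) ^ (h + 1) * q := by
  -- The equation at `(i, j)` involves only the entries `(i + 1, j)` and `(i, j - 1)`, which lower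
  -- `n - 1 - i + j` by one. Their divisor is the same, because linked indices have equal
  -- eigenvalues.
  induction h using Nat.strong_induction_on with
  | _ h ih =>
    intro i j hij hfar
    have hq0 : 0 ≤ q := (norm_nonneg _).trans (hq i j)
    have hρi : 1 ≤ ρ⁻¹ := (one_le_inv₀ hρ).mpr hρ1
    have hρi0 : 0 < ρ⁻¹ := inv_pos.mpr hρ
    have hmain : ∀ c : ℝ, 0 ≤ c → ‖(offDiag B * X) i j‖ ≤ c → ‖(X * offDiag B) i j‖ ≤ c →
        ‖X i j‖ ≤ ρ⁻¹ * (q + 2 * c) := by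
      intro c hc h1 h2
      have h3 : ρ * ‖X i j‖ ≤ q + 2 * c := by
        calc ρ * ‖X i j‖ ≤ ‖B i i - (starRingEnd ℂ) (B j j) - μ‖ * ‖X i j‖ := by gcongr
          _ = ‖-Γ i j - (offDiag B * X) i j + (X * offDiag B) i j‖ := by
            rw [← norm_mul, heq]
          _ ≤ ‖Γ i j‖ + ‖(offDiag B * X) i j‖ + ‖(X * offDiag B) i j‖ := by
            refine (norm_add_le _ _).trans (add_le_add_left ?_ _)
            refine (norm_sub_le _ _).trans ?_
            rw [norm_neg]
          _ ≤ q + 2 * c := by linarith [hq i j]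
      rw [inv_mul_eq_div, le_div_iff₀ hρ]
      linarith
    rcases Nat.eq_zero_or_pos h with rfl | hpos
    · have h1 : ‖(offDiag B * X) i j‖ ≤ 0 :=
        norm_offDiag_mul_apply_le hB le_rfl fun l hl _ => by have := l.2; omega
      have h2 : ‖(X * offDiag B) i j‖ ≤ 0 :=
        norm_mul_offDiag_apply_le hB le_rfl fun l hl _ => by omega
      simpa using hmain 0 le_rfl h1 h2
    · obtain ⟨h, rfl⟩ : ∃ h', h = h' + 1 := ⟨h - 1, by omega⟩
      have hc0 : 0 ≤ 3 ^ h * (ρ⁻¹) ^ (h + 1) * q := by positivity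
      have h1 : ‖(offDiag B * X) i j‖ ≤ 3 ^ h * (ρ⁻¹) ^ (h + 1) * q :=
        norm_offDiag_mul_apply_le hB hc0 fun l hl hlk =>
          ih h (by omega) l j (by have := l.2; omega) (by rwa [← jordanLink_diag hB hl hlk])
      have h2 : ‖(X * offDiag B) i j‖ ≤ 3 ^ h * (ρ⁻¹) ^ (h + 1) * q :=
        norm_mul_offDiag_apply_le hB hc0 fun l hl hlk =>
          ih h (by omega) i l (by omega) (by rwa [jordanLink_diag hB hl hlk])
      refine (hmain _ hc0 h1 h2).trans ?_
      have h3 : q ≤ 3 ^ h * (ρ⁻¹) ^ (h + 1) * q := by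
        refine le_mul_of_one_le_left hq0 ?_
        exact one_le_mul_of_one_le_of_one_le (one_le_pow₀ (by norm_num)) (one_le_pow₀ hρi)
      calc ρ⁻¹ * (q + 2 * (3 ^ h * (ρ⁻¹) ^ (h + 1) * q))
          ≤ ρ⁻¹ * (3 ^ h * (ρ⁻¹) ^ (h + 1) * q + 2 * (3 ^ h * (ρ⁻¹) ^ (h + 1) * q)) := by gcongr
        _ = 3 ^ (h + 1) * (ρ⁻¹) ^ (h + 1 + 1) * q := by ring

/-- The induction has at most `2 * n - 2` steps, so at most `2 * n - 1` divisions by `ρ`: this is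
the power of `ρ` in the smallness assumption on `G`. -/
lemma norm_sylvester_le' (hB : IsJordanForm B) {X Γ : Matrix (Fin n) (Fin n) ℂ} {μ : ℂ} {ρ q : ℝ}
    (hρ : 0 < ρ) (hρ1 : ρ ≤ 1) (hq : ∀ i j, ‖Γ i j‖ ≤ q)
    (heq : ∀ i j, (B i i - (starRingEnd ℂ) (B j j) - μ) * X i j =
      -Γ i j - (offDiag B * X) i j + (X * offDiag B) i j) (i j : Fin n)
    (hfar : ρ < ‖B i i - (starRingEnd ℂ) (B j j) - μ‖) :
    ‖X i j‖ ≤ 9 ^ n * (ρ⁻¹) ^ (2 * n - 1) * q := by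
  have hq0 : 0 ≤ q := (norm_nonneg _).trans (hq i j)
  have hρi : 1 ≤ ρ⁻¹ := (one_le_inv₀ hρ).mpr hρ1
  refine (norm_sylvester_le hB hρ hρ1 hq heq _ i j rfl hfar).trans ?_
  have h1 : n - 1 - (i : ℕ) + j + 1 ≤ 2 * n - 1 := by omega
  have h2 : (3 : ℝ) ^ (n - 1 - (i : ℕ) + j) ≤ 9 ^ n := by
    rw [show (9 : ℝ) = 3 ^ 2 by norm_num, ← pow_mul]
    exact pow_le_pow_right₀ (by norm_num) (by omega)
  gcongr

end Sylvester
end QPCocycle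

namespace QPCocycle

/-! ### Truncation of `U` to its almost resonant modes. -/

section ApproximateIntertwiner

variable {d n : ℕ} {B : Matrix (Fin n) (Fin n) ℂ} {ω : Fin d → ℝ}

lemma IsTorusFun.sub {E : Type*} [AddGroup E] {f g : (Fin d → ℝ) → E} (hf : IsTorusFun f)
    (hg : IsTorusFun g) : IsTorusFun fun θ => f θ - g θ := fun θ k => by
  simp only [hf θ k, hg θ k]

/-- The matrix of Fourier coefficients of a matrix-valued function. -/
noncomputable def matCoeff (F : (Fin d → ℝ) → Matrix (Fin n) (Fin n) ℂ) (k : Fin d → ℤ) :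
    Matrix (Fin n) (Fin n) ℂ :=
  Matrix.of fun i j => torusCoeff (fun θ => F θ i j) k

lemma matCoeff_defect {U G : (Fin d → ℝ) → Matrix (Fin n) (Fin n) ℂ} (hU : IsTorusFun U)
    (hUc : ContDiff ℝ 1 U)
    (hG : ∀ θ, G θ = dirDeriv ω U θ - B * U θ + U θ * conjMat B) (k : Fin d → ℤ) :
    matCoeff G k = charFreq k ω • matCoeff U k - B * matCoeff U k + matCoeff U k * conjMat B := by
  ext i j
  have hUe := fun i j => isTorusFun_entry hU i j
  have hUec := fun i j => contDiff_entry hUc i j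
  have h1 : (fun θ => G θ i j) = fun θ =>
      (dirDeriv ω (fun θ => U θ i j) θ - ∑ l, B i l * U θ l j) +
        ∑ l, conjMat B l j * U θ i l := by
    funext θ
    rw [hG, Matrix.add_apply, Matrix.sub_apply, Matrix.mul_apply, Matrix.mul_apply,
      dirDeriv_entry (hUc.differentiable one_ne_zero)]
    simp only [mul_comm]
  have hp1 : IsTorusFun fun θ => ∑ l, B i l * U θ l j := fun θ m => by simp only [hU θ m]
  have hp2 : IsTorusFun fun θ => ∑ l, conjMat B l j * U θ i l := fun θ m => by simp only [hU θ m]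
  have hc1 : Continuous fun θ => ∑ l, B i l * U θ l j :=
    continuous_finsetSum _ fun l _ => continuous_const.mul (hUec l j).continuous
  have hc2 : Continuous fun θ => ∑ l, conjMat B l j * U θ i l :=
    continuous_finsetSum _ fun l _ => continuous_const.mul (hUec i l).continuous
  have hp0 := isTorusFun_dirDeriv (hUe i j) ω
  have hc0 := continuous_dirDeriv (hUec i j) ω
  change torusCoeff (fun θ => G θ i j) k = _
  have hc01 : Continuous fun θ =>
      dirDeriv ω (fun θ => U θ i j) θ - ∑ l, B i l * U θ l j := hc0.sub hc1
  rw [h1, torusCoeff_add (hp0.sub hp1) hc01 hp2 hc2,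
    torusCoeff_sub hp0 hc0 hp1 hc1, torusCoeff_dirDeriv (hUe i j) (hUec i j),
    torusCoeff_sum _ _ (fun l _ => hUe l j) (fun l _ => (hUec l j).continuous),
    torusCoeff_sum _ _ (fun l _ => hUe i l) (fun l _ => (hUec i l).continuous)]
  simp only [Matrix.add_apply, Matrix.sub_apply, Matrix.smul_apply, Matrix.mul_apply, matCoeff,
    Matrix.of_apply, smul_eq_mul, mul_comm]

lemma sylvester_of_defect (hB : IsJordanForm B) {X Γ : Matrix (Fin n) (Fin n) ℂ} {μ : ℂ}
    (h : Γ = μ • X - B * X + X * conjMat B) (i j : Fin n) :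
    (B i i - (starRingEnd ℂ) (B j j) - μ) * X i j =
      -Γ i j - (offDiag B * X) i j + (X * offDiag B) i j := by
  have h1 : (B * X) i j = B i i * X i j + (offDiag B * X) i j := by
    conv_lhs => rw [← diagonal_add_offDiag B]
    rw [add_mul, Matrix.add_apply, Matrix.diagonal_mul]
  have h2 : (X * conjMat B) i j = X i j * (starRingEnd ℂ) (B j j) + (X * offDiag B) i j := by
    rw [conjMat_eq_diagonal_add_offDiag hB, mul_add, Matrix.add_apply, Matrix.mul_diagonal]
  rw [h, Matrix.add_apply, Matrix.sub_apply, Matrix.smul_apply, h1, h2, smul_eq_mul]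
  ring

open Classical in
/-- The almost resonant frequencies of size at most `N` of the entry `(i, j)`. -/
noncomputable def resonantFreqs (B : Matrix (Fin n) (Fin n) ℂ) (ω : Fin d → ℝ) (N : ℕ) (ρ : ℝ)
    (i j : Fin n) : Finset (Fin d → ℤ) :=
  (Fintype.piFinset fun _ => Finset.Icc (-(N : ℤ)) N).filter fun k =>
    ‖B i i - (starRingEnd ℂ) (B j j) - charFreq k ω‖ ≤ ρ

variable {N : ℕ} {ρ : ℝ}

lemma mem_resonantFreqs {i j : Fin n} {k : Fin d → ℤ} :
    k ∈ resonantFreqs B ω N ρ i j ↔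
      (∀ a, |(k a : ℝ)| ≤ N) ∧ ‖B i i - (starRingEnd ℂ) (B j j) - charFreq k ω‖ ≤ ρ := by
  have h : ∀ a, (-(N : ℤ) ≤ k a ∧ k a ≤ N) ↔ |(k a : ℝ)| ≤ N := fun a => by
    rw [← abs_le]
    exact_mod_cast Iff.rfl
  simp [resonantFreqs, Fintype.mem_piFinset, h]

/-- The part of `U` carried by the almost resonant frequencies. -/
noncomputable def resonantPart (B : Matrix (Fin n) (Fin n) ℂ) (ω : Fin d → ℝ) (N : ℕ) (ρ : ℝ)
    (U : (Fin d → ℝ) → Matrix (Fin n) (Fin n) ℂ) (θ : Fin d → ℝ) : Matrix (Fin n) (Fin n) ℂ :=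
  Matrix.of fun i j => ∑ k ∈ resonantFreqs B ω N ρ i j, matCoeff U k i j * torusChar k θ

variable {U G : (Fin d → ℝ) → Matrix (Fin n) (Fin n) ℂ}

lemma isTorusFun_resonantPart : IsTorusFun (resonantPart B ω N ρ U) := fun θ k => by
  simp only [resonantPart, isTorusFun_torusChar _ θ k]

lemma continuous_resonantPart_entry (i j : Fin n) :
    Continuous fun θ => resonantPart B ω N ρ U θ i j :=
  continuous_finsetSum _ fun k _ =>
    continuous_const.mul (contDiff_torusChar k (r := 0)).continuous

open Classical in
lemma matCoeff_resonantPart (k : Fin d → ℤ) (i j : Fin n) :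
    matCoeff (resonantPart B ω N ρ U) k i j =
      if k ∈ resonantFreqs B ω N ρ i j then matCoeff U k i j else 0 := by
  change torusCoeff (fun θ => ∑ k ∈ resonantFreqs B ω N ρ i j,
    matCoeff U k i j * torusChar k θ) k = _
  rw [torusCoeff_sum _ _ (fun l _ => isTorusFun_torusChar l)
    (fun l _ => (contDiff_torusChar l (r := 0)).continuous)]
  simp only [torusCoeff_torusChar, mul_ite, mul_one, mul_zero, Finset.sum_ite_eq']

lemma nearModFreq_of_resonantPart_ne_zero {θ : Fin d → ℝ} {i j : Fin n}
    (h : resonantPart B ω N ρ U θ i j ≠ 0) :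
    NearModFreq ω N ρ 1 (B i i) ((starRingEnd ℂ) (B j j)) := by
  obtain ⟨k, hk, _⟩ := Finset.exists_ne_zero_of_sum_ne_zero h
  obtain ⟨h1, h2⟩ := mem_resonantFreqs.mp hk
  exact ⟨k, by simpa using h1, by simpa using h2⟩

/-- The non-resonant part of an approximate conjugation is small in mean square. -/
lemma meanSq_sub_resonantPart_le (hB : IsJordanForm B) (hN : 1 ≤ N) (hρ : 0 < ρ) (hρ1 : ρ ≤ 1)
    (hU : IsTorusFun U) (hUc : ContDiff ℝ 1 U)
    (hG : ∀ θ, G θ = dirDeriv ω U θ - B * U θ + U θ * conjMat B)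
    (hGp : IsTorusFun G) (hGc : Continuous G) {u₁ g : ℝ}
    (hu₁ : ∀ a θ, ‖dirDeriv (Pi.single a (1 : ℝ)) U θ‖ ≤ u₁) (hg : ∀ θ, ‖G θ‖ ≤ g)
    (i j : Fin n) :
    meanSq (fun θ => U θ i j - resonantPart B ω N ρ U θ i j) ≤
      d * (u₁ ^ 2 / N ^ 2) + (9 ^ n * (ρ⁻¹) ^ (2 * n - 1)) ^ 2 * (n ^ 2 * g ^ 2) := by
  classical
  have hN0 : (0 : ℝ) < N := by exact_mod_cast hN
  have hUe := isTorusFun_entry hU i j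
  have hUec := contDiff_entry hUc i j
  have hVe := isTorusFun_entry (isTorusFun_resonantPart (B := B) (ω := ω) (N := N) (ρ := ρ)
    (U := U)) i j
  have hVc := continuous_resonantPart_entry (B := B) (ω := ω) (N := N) (ρ := ρ) (U := U) i j
  have hcoef : ∀ k, torusCoeff (fun θ => U θ i j - resonantPart B ω N ρ U θ i j) k =
      if k ∈ resonantFreqs B ω N ρ i j then 0 else matCoeff U k i j := by
    intro k
    rw [torusCoeff_sub hUe hUec.continuous hVe hVc]
    have h1 := matCoeff_resonantPart (B := B) (ω := ω) (N := N) (ρ := ρ) (U := U) k i j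
    change matCoeff U k i j - matCoeff (resonantPart B ω N ρ U) k i j = _
    rw [h1]
    split_ifs <;> simp
  set M : ℝ := 9 ^ n * (ρ⁻¹) ^ (2 * n - 1) with hM
  have hS := hasSum_sq_torusCoeff (f := fun θ => U θ i j - resonantPart B ω N ρ U θ i j)
    (hUe.sub hVe) (hUec.continuous.sub hVc)
  have hS1 : HasSum (fun k => ∑ a : Fin d, ‖charFreq k (Pi.single a 1) * matCoeff U k i j‖ ^ 2 / N ^ 2)
      (∑ a : Fin d, meanSq (dirDeriv (Pi.single a 1) fun θ => U θ i j) / N ^ 2) := by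
    refine hasSum_sum fun a _ => ?_
    have := (hasSum_sq_torusCoeff (isTorusFun_dirDeriv hUe (Pi.single a 1))
      (continuous_dirDeriv hUec (Pi.single a 1))).div_const ((N : ℝ) ^ 2)
    simp only [torusCoeff_dirDeriv hUe hUec] at this
    exact this
  have hS2 : HasSum (fun k => ∑ p : Fin n × Fin n, ‖matCoeff G k p.1 p.2‖ ^ 2)
      (∑ p : Fin n × Fin n, meanSq fun θ => G θ p.1 p.2) :=
    hasSum_sum fun p _ => hasSum_sq_torusCoeff (isTorusFun_entry hGp _ _) (continuous_entry hGc _ _)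
  -- A resonant mode contributes nothing. If some `|k a| > N`, the `a`-th derivative multiplies the
  -- coefficient by more than `N`; otherwise the divisor exceeds `ρ` and the Sylvester bound
  -- applies. Both majorants are summable by Parseval.
  have hle : ∀ k, ‖torusCoeff (fun θ => U θ i j - resonantPart B ω N ρ U θ i j) k‖ ^ 2 ≤
      ∑ a : Fin d, ‖charFreq k (Pi.single a 1) * matCoeff U k i j‖ ^ 2 / N ^ 2 +
        M ^ 2 * ∑ p : Fin n × Fin n, ‖matCoeff G k p.1 p.2‖ ^ 2 := by
    intro k
    have ht1 : ∀ a : Fin d, 0 ≤ ‖charFreq k (Pi.single a 1) * matCoeff U k i j‖ ^ 2 / (N : ℝ) ^ 2 :=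
      fun a => by positivity
    have ht2 : 0 ≤ ∑ p : Fin n × Fin n, ‖matCoeff G k p.1 p.2‖ ^ 2 :=
      Finset.sum_nonneg fun p _ => by positivity
    rw [hcoef]
    split_ifs with hk
    · rw [norm_zero, zero_pow two_ne_zero]
      have := Finset.sum_nonneg fun (a : Fin d) (_ : a ∈ Finset.univ) => ht1 a
      positivity
    · by_cases hbig : ∃ a, (N : ℝ) < |(k a : ℝ)|
      · obtain ⟨a, ha⟩ := hbig
        have h1 : ‖matCoeff U k i j‖ ^ 2 ≤
            ‖charFreq k (Pi.single a 1) * matCoeff U k i j‖ ^ 2 / (N : ℝ) ^ 2 := by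
          rw [le_div_iff₀ (by positivity), ← mul_pow]
          refine pow_le_pow_left₀ (by positivity) ?_ 2
          rw [norm_mul, mul_comm]
          refine mul_le_mul_of_nonneg_right ?_ (norm_nonneg _)
          rw [charFreq_single]
          simp only [norm_mul, Complex.norm_I, mul_one, Complex.norm_real, Complex.norm_ofNat,
            Real.norm_eq_abs, abs_of_pos Real.pi_pos, Complex.norm_intCast]
          nlinarith [Real.pi_gt_three]
        have h2 := Finset.single_le_sum (fun a _ => ht1 a) (Finset.mem_univ a)
        have h3 : 0 ≤ M ^ 2 * ∑ p : Fin n × Fin n, ‖matCoeff G k p.1 p.2‖ ^ 2 := by positivity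
        linarith
      · push Not at hbig
        have hfar : ρ < ‖B i i - (starRingEnd ℂ) (B j j) - charFreq k ω‖ := by
          by_contra hc
          exact hk (mem_resonantFreqs.mpr ⟨hbig, not_lt.mp hc⟩)
        have hq : ∀ a b, ‖matCoeff G k a b‖ ≤
            √(∑ p : Fin n × Fin n, ‖matCoeff G k p.1 p.2‖ ^ 2) := by
          intro a b
          apply Real.le_sqrt_of_sq_le
          exact Finset.single_le_sum (f := fun p : Fin n × Fin n => ‖matCoeff G k p.1 p.2‖ ^ 2)
            (fun p _ => by positivity) (Finset.mem_univ (a, b))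
        have h1 := norm_sylvester_le' hB hρ hρ1 hq
          (sylvester_of_defect hB (matCoeff_defect hU hUc hG k)) i j hfar
        have h2 := pow_le_pow_left₀ (norm_nonneg _) h1 2
        rw [mul_pow, Real.sq_sqrt ht2] at h2
        have := Finset.sum_nonneg fun (a : Fin d) (_ : a ∈ Finset.univ) => ht1 a
        linarith
  refine (hasSum_le hle hS (hS1.add (hS2.mul_left (M ^ 2)))).trans ?_
  refine add_le_add ?_ (mul_le_mul_of_nonneg_left ?_ (by positivity))
  · calc _ ≤ ∑ _a : Fin d, u₁ ^ 2 / (N : ℝ) ^ 2 := by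
          refine Finset.sum_le_sum fun a _ => ?_
          refine div_le_div_of_nonneg_right (meanSq_le (isTorusFun_dirDeriv hUe _)
            (continuous_dirDeriv hUec _) fun θ => ?_) (by positivity)
          rw [dirDeriv_entry (hUc.differentiable one_ne_zero)]
          exact (norm_entry_le_l2_opNorm _ i j).trans (hu₁ a θ)
      _ = d * (u₁ ^ 2 / N ^ 2) := by simp
  · calc _ ≤ ∑ _p : Fin n × Fin n, g ^ 2 := Finset.sum_le_sum fun p _ =>
          meanSq_le (isTorusFun_entry hGp _ _) (continuous_entry hGc _ _) fun θ =>
            (norm_entry_le_l2_opNorm _ _ _).trans (hg θ)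
      _ = n ^ 2 * g ^ 2 := by
          rw [Finset.sum_const, Finset.card_univ, Fintype.card_prod, Fintype.card_fin,
            nsmul_eq_mul]
          push_cast
          ring

/-- The resonant part almost commutes with the nilpotent part of `B`, in mean square. -/
lemma meanSq_commutator_resonantPart_le (hB : IsJordanForm B) (hρ : 0 < ρ)
    (hU : IsTorusFun U) (hUc : ContDiff ℝ 1 U)
    (hG : ∀ θ, G θ = dirDeriv ω U θ - B * U θ + U θ * conjMat B)
    (hGp : IsTorusFun G) (hGc : Continuous G) {u g : ℝ}
    (hu : ∀ θ, ‖U θ‖ ≤ u) (hg : ∀ θ, ‖G θ‖ ≤ g) (i j : Fin n) :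
    meanSq (fun θ => (offDiag B * resonantPart B ω N ρ U θ -
      resonantPart B ω N ρ U θ * offDiag B) i j) ≤ 2 * g ^ 2 + 2 * (ρ ^ 2 * u ^ 2) := by
  classical
  have hVp := isTorusFun_resonantPart (B := B) (ω := ω) (N := N) (ρ := ρ) (U := U)
  have hVe := fun i j => isTorusFun_entry hVp i j
  have hVc := continuous_resonantPart_entry (B := B) (ω := ω) (N := N) (ρ := ρ) (U := U)
  have hfun : (fun θ => (offDiag B * resonantPart B ω N ρ U θ -
      resonantPart B ω N ρ U θ * offDiag B) i j) = fun θ =>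
      ∑ l, offDiag B i l * resonantPart B ω N ρ U θ l j -
        ∑ l, offDiag B l j * resonantPart B ω N ρ U θ i l := by
    funext θ
    simp only [Matrix.sub_apply, Matrix.mul_apply, mul_comm]
  have hp1 : IsTorusFun fun θ => ∑ l, offDiag B i l * resonantPart B ω N ρ U θ l j :=
    fun θ m => by simp only [hVp θ m]
  have hp2 : IsTorusFun fun θ => ∑ l, offDiag B l j * resonantPart B ω N ρ U θ i l :=
    fun θ m => by simp only [hVp θ m]
  have hc1 : Continuous fun θ => ∑ l, offDiag B i l * resonantPart B ω N ρ U θ l j :=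
    continuous_finsetSum _ fun l _ => continuous_const.mul (hVc l j)
  have hc2 : Continuous fun θ => ∑ l, offDiag B l j * resonantPart B ω N ρ U θ i l :=
    continuous_finsetSum _ fun l _ => continuous_const.mul (hVc i l)
  -- Resonance of an entry depends only on its two eigenvalues, which are constant along chains; so
  -- truncation commutes with multiplication by the nilpotent part on either side.
  have hcoef : ∀ k, torusCoeff (fun θ => ∑ l, offDiag B i l * resonantPart B ω N ρ U θ l j -
        ∑ l, offDiag B l j * resonantPart B ω N ρ U θ i l) k =
      if k ∈ resonantFreqs B ω N ρ i j then
        (offDiag B * matCoeff U k) i j - (matCoeff U k * offDiag B) i j else 0 := by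
    intro k
    rw [torusCoeff_sub hp1 hc1 hp2 hc2,
      torusCoeff_sum _ _ (fun l _ => hVe l j) (fun l _ => hVc l j),
      torusCoeff_sum _ _ (fun l _ => hVe i l) (fun l _ => hVc i l)]
    change ∑ l, offDiag B i l * matCoeff (resonantPart B ω N ρ U) k l j -
      ∑ l, offDiag B l j * matCoeff (resonantPart B ω N ρ U) k i l = _
    have e1 : ∀ l, offDiag B i l * matCoeff (resonantPart B ω N ρ U) k l j =
        if k ∈ resonantFreqs B ω N ρ i j then offDiag B i l * matCoeff U k l j else 0 := by
      intro l
      rw [matCoeff_resonantPart, offDiag_apply hB]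
      by_cases hl : (l : ℕ) = i + 1 ∧ jordanLink B i
      · have : k ∈ resonantFreqs B ω N ρ l j ↔ k ∈ resonantFreqs B ω N ρ i j := by
          rw [mem_resonantFreqs, mem_resonantFreqs, jordanLink_diag hB hl.1 hl.2]
        simp only [this, mul_ite, mul_zero]
      · simp [hl]
    have e2 : ∀ l, offDiag B l j * matCoeff (resonantPart B ω N ρ U) k i l =
        if k ∈ resonantFreqs B ω N ρ i j then offDiag B l j * matCoeff U k i l else 0 := by
      intro l
      rw [matCoeff_resonantPart, offDiag_apply hB]
      by_cases hl : (j : ℕ) = l + 1 ∧ jordanLink B l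
      · have : k ∈ resonantFreqs B ω N ρ i l ↔ k ∈ resonantFreqs B ω N ρ i j := by
          rw [mem_resonantFreqs, mem_resonantFreqs, jordanLink_diag hB hl.1 hl.2]
        simp only [this, mul_ite, mul_zero]
      · simp [hl]
    simp only [e1, e2]
    split_ifs
    · simp only [Matrix.mul_apply, mul_comm]
    · simp
  rw [hfun]
  have hc12 : Continuous fun θ => ∑ l, offDiag B i l * resonantPart B ω N ρ U θ l j -
      ∑ l, offDiag B l j * resonantPart B ω N ρ U θ i l := hc1.sub hc2
  have hS := hasSum_sq_torusCoeff (hp1.sub hp2) hc12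
  have hUe := isTorusFun_entry hU i j
  have hUec := (contDiff_entry hUc i j).continuous
  have hS1 := (hasSum_sq_torusCoeff (isTorusFun_entry hGp i j)
    (continuous_entry hGc i j)).mul_left 2
  have hS2 := ((hasSum_sq_torusCoeff hUe hUec).mul_left (ρ ^ 2)).mul_left 2
  refine (hasSum_le (fun k => ?_) hS (hS1.add hS2)).trans ?_
  · rw [hcoef]
    change _ ≤ 2 * ‖matCoeff G k i j‖ ^ 2 + 2 * (ρ ^ 2 * ‖matCoeff U k i j‖ ^ 2)
    split_ifs with hk
    · have h1 := sylvester_of_defect hB (matCoeff_defect hU hUc hG k) i j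
      -- At a resonant mode the Sylvester equation is read the other way: the divisor is at most
      -- `ρ`, so the commutator itself is small.
      have h2 : (offDiag B * matCoeff U k) i j - (matCoeff U k * offDiag B) i j =
          -matCoeff G k i j -
          (B i i - (starRingEnd ℂ) (B j j) - charFreq k ω) * matCoeff U k i j := by
        rw [h1]; ring
      have h3 : ‖(offDiag B * matCoeff U k) i j - (matCoeff U k * offDiag B) i j‖ ≤
          ‖matCoeff G k i j‖ + ρ * ‖matCoeff U k i j‖ := by
        rw [h2]
        refine (norm_sub_le _ _).trans ?_
        rw [norm_neg, norm_mul]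
        have := (mem_resonantFreqs.mp hk).2
        gcongr
      have h4 := pow_le_pow_left₀ (norm_nonneg _) h3 2
      nlinarith [sq_nonneg (‖matCoeff G k i j‖ - ρ * ‖matCoeff U k i j‖)]
    · rw [norm_zero, zero_pow two_ne_zero]; positivity
  · have h1 := meanSq_le (isTorusFun_entry hGp i j) (continuous_entry hGc i j) fun θ =>
      (norm_entry_le_l2_opNorm _ _ _).trans (hg θ)
    have h2 := meanSq_le hUe hUec fun θ => (norm_entry_le_l2_opNorm _ _ _).trans (hu θ)
    gcongr

/-- At a suitable point of the torus an approximate conjugation is close to a matrix supported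
on almost resonant entries which almost commutes with the nilpotent part of `B`. -/
lemma exists_approximate_intertwiner (hB : IsJordanForm B) (hN : 1 ≤ N) (hρ : 0 < ρ) (hρ1 : ρ ≤ 1)
    (hU : IsTorusFun U) (hUc : ContDiff ℝ 1 U)
    (hG : ∀ θ, G θ = dirDeriv ω U θ - B * U θ + U θ * conjMat B)
    (hGp : IsTorusFun G) (hGc : Continuous G) {u u₁ g : ℝ} (hu : ∀ θ, ‖U θ‖ ≤ u)
    (hu₁ : ∀ a θ, ‖dirDeriv (Pi.single a (1 : ℝ)) U θ‖ ≤ u₁) (hg : ∀ θ, ‖G θ‖ ≤ g) {R : ℝ}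
    (hR : 2 * n ^ 2 * (d * (u₁ ^ 2 / N ^ 2) +
      (9 ^ n * (ρ⁻¹) ^ (2 * n - 1)) ^ 2 * (n ^ 2 * g ^ 2) + (2 * g ^ 2 + 2 * (ρ ^ 2 * u ^ 2))) ≤ R) :
    ∃ (θ : Fin d → ℝ) (V : Matrix (Fin n) (Fin n) ℂ),
      (∀ i j, V i j ≠ 0 → NearModFreq ω N ρ 1 (B i i) ((starRingEnd ℂ) (B j j))) ∧
      (∀ i j, ‖(U θ - V) i j‖ ^ 2 ≤ R) ∧
      (∀ i j, ‖(offDiag B * V - V * offDiag B) i j‖ ^ 2 ≤ R) := by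
  -- All entries of the truncation error and of the commutator form a single family, so that one `θ`
  -- serves for both.
  let f : (Fin n × Fin n) × Bool → (Fin d → ℝ) → ℂ := fun p θ =>
    if p.2 then (U θ - resonantPart B ω N ρ U θ) p.1.1 p.1.2
    else (offDiag B * resonantPart B ω N ρ U θ -
      resonantPart B ω N ρ U θ * offDiag B) p.1.1 p.1.2
  have hVp := isTorusFun_resonantPart (B := B) (ω := ω) (N := N) (ρ := ρ) (U := U)
  have hVc := continuous_resonantPart_entry (B := B) (ω := ω) (N := N) (ρ := ρ) (U := U)
  have hfp : ∀ p, IsTorusFun (f p) := fun p θ k => by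
    simp only [f, hU θ k, hVp θ k]
  have hfc : ∀ p, Continuous (f p) := by
    rintro ⟨⟨i, j⟩, b⟩
    cases b
    · simp only [f, Matrix.sub_apply, Matrix.mul_apply, Bool.false_eq_true, if_false]
      exact (continuous_finsetSum _ fun l _ => continuous_const.mul (hVc l j)).sub
        (continuous_finsetSum _ fun l _ => (hVc i l).mul continuous_const)
    · simp only [f, Matrix.sub_apply, if_true]
      exact (contDiff_entry hUc i j).continuous.sub (hVc i j)
  obtain ⟨θ, hθ⟩ := exists_sum_sq_le_sum_meanSq hfp hfc
  have hsum : ∑ p, meanSq (f p) ≤ R := by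
    refine le_trans ?_ hR
    rw [Fintype.sum_prod_type]
    calc _ ≤ ∑ _p : Fin n × Fin n, (d * (u₁ ^ 2 / N ^ 2) +
          (9 ^ n * (ρ⁻¹) ^ (2 * n - 1)) ^ 2 * (n ^ 2 * g ^ 2) +
            (2 * g ^ 2 + 2 * (ρ ^ 2 * u ^ 2))) := by
          refine Finset.sum_le_sum fun p _ => ?_
          rw [Fintype.sum_bool]
          exact add_le_add
            (meanSq_sub_resonantPart_le hB hN hρ hρ1 hU hUc hG hGp hGc hu₁ hg p.1 p.2)
            (meanSq_commutator_resonantPart_le hB hρ hU hUc hG hGp hGc hu hg p.1 p.2)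
      _ ≤ _ := by
          rw [Finset.sum_const, Finset.card_univ, Fintype.card_prod, Fintype.card_fin,
            nsmul_eq_mul]
          push_cast
          have h0 : 0 ≤ (n : ℝ) ^ 2 * (d * (u₁ ^ 2 / N ^ 2) +
            (9 ^ n * (ρ⁻¹) ^ (2 * n - 1)) ^ 2 * (n ^ 2 * g ^ 2) +
              (2 * g ^ 2 + 2 * (ρ ^ 2 * u ^ 2))) := by positivity
          linarith
  have hone : ∀ p, ‖f p θ‖ ^ 2 ≤ R := fun p =>
    (Finset.single_le_sum (f := fun p => ‖f p θ‖ ^ 2) (fun _ _ => by positivity)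
      (Finset.mem_univ p)).trans (hθ.trans hsum)
  exact ⟨θ, resonantPart B ω N ρ U θ, fun i j h => nearModFreq_of_resonantPart_ne_zero h,
    fun i j => hone ((i, j), true), fun i j => hone ((i, j), false)⟩

end ApproximateIntertwiner
end QPCocycle

namespace QPCocycle

/-! ### Conjugate inverses, choice of constants and the theorem. -/

section MainTheorem

variable {n : ℕ}

/-- `conjMat A` is `A` preceded and followed by coordinatewise conjugation, which is an isometry. -/
lemma norm_conjMat_le (A : Matrix (Fin n) (Fin n) ℂ) : ‖conjMat A‖ ≤ ‖A‖ := by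
  rw [Matrix.l2_opNorm_def]
  refine ContinuousLinearMap.opNorm_le_bound _ (norm_nonneg _) fun x => ?_
  have h := Matrix.l2_opNorm_mulVec A
    (WithLp.toLp 2 fun i => (starRingEnd ℂ) (x i) : EuclideanSpace ℂ (Fin n))
  rw [EuclideanSpace.norm_eq, EuclideanSpace.norm_eq] at h
  rw [EuclideanSpace.norm_eq, EuclideanSpace.norm_eq]
  simp only [RCLike.norm_conj] at h
  refine le_trans (le_of_eq ?_) h
  congr 1
  refine Finset.sum_congr rfl fun i _ => ?_
  congr 1
  change ‖∑ j, conjMat A i j * x j‖ = ‖∑ j, A i j * (starRingEnd ℂ) (x j)‖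
  rw [← RCLike.norm_conj, map_sum]
  simp [conjMat]

lemma one_le_norm_of_mul_conjMat (hn : 0 < n) {A : Matrix (Fin n) (Fin n) ℂ}
    (h : A * conjMat A = 1) : 1 ≤ ‖A‖ := by
  have h1 := norm_entry_le_l2_opNorm (1 : Matrix (Fin n) (Fin n) ℂ) ⟨0, hn⟩ ⟨0, hn⟩
  rw [Matrix.one_apply_eq, norm_one, ← h] at h1
  have h2 := norm_mul_le A (conjMat A)
  have h3 := norm_conjMat_le A
  nlinarith [norm_nonneg A]

end MainTheorem

end QPCocycle

open QPCocycle in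
theorem mainTheorem9 (d n : ℕ) (hd : 1 ≤ d) (hn : 1 ≤ n) :
    ∃ C₁ : ℝ, 0 < C₁ ∧
      ∀ (ω : Fin d → ℝ) (κ τ : ℝ), QPCocycle.IsDiophantine ω κ τ →
      ∀ (N : ℕ) (ρ : ℝ), 0 < ρ →
      ∀ (U : (Fin d → ℝ) → Matrix (Fin n) (Fin n) ℂ),
        QPCocycle.IsTorusFun U →
        ContDiff ℝ ((d + 1 : ℕ) : WithTop ℕ∞) U →
        (∀ θ, IsUnit (U θ)) →
        (∀ θ, (U θ)⁻¹ = QPCocycle.conjMat (U θ)) →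
      ∀ (B : Matrix (Fin n) (Fin n) ℂ), QPCocycle.IsJordanForm B →
      ∀ (G : (Fin d → ℝ) → Matrix (Fin n) (Fin n) ℂ),
        (∀ θ, G θ = QPCocycle.dirDeriv ω U θ - B * U θ + U θ * QPCocycle.conjMat B) →
        ContDiff ℝ ((d + 1 : ℕ) : WithTop ℕ∞) G →
        C₁ * QPCocycle.cNorm (d + 1) U * QPCocycle.cNorm 0 U ≤ (N : ℝ) →
        QPCocycle.cNorm (d + 1) G ≤
          C₁⁻¹ * ρ ^ (2 * n - 1) * ((N : ℝ) ^ (d - 1))⁻¹ * (QPCocycle.cNorm 0 U ^ n)⁻¹ →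
        ρ ≤ C₁⁻¹ * min (1 / ((N : ℝ) ^ d * QPCocycle.cNorm 0 U ^ (n + 1)))
          (κ / (N : ℝ) ^ τ) →
      ∃ (W : (Fin d → ℝ) → Matrix (Fin n) (Fin n) ℂ)
        (B' : Matrix (Fin n) (Fin n) ℝ) (B'' : Matrix (Fin n) (Fin n) ℂ),
        QPCocycle.IsTorusFun W ∧
        ContDiff ℝ ((⊤ : ℕ∞) : WithTop ℕ∞) W ∧
        (∀ θ, IsUnit (W θ)) ∧
        (∀ θ, QPCocycle.dirDeriv ((1 / 2 : ℝ) • ω) W θ =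
          B * W θ - W θ * (QPCocycle.toComplexMat B' + B'')) ∧
        ‖B''‖ ≤ 2 * (n : ℝ) ^ 2 * ρ ∧
        (∀ s : ℕ,
          QPCocycle.cNorm s W ≤ (2 * Real.pi * n * N) ^ (2 * s) ∧
          QPCocycle.cNorm s (fun θ => (W θ)⁻¹) ≤ (2 * Real.pi * n * N) ^ (2 * s)) ∧
        ‖QPCocycle.toComplexMat B'‖ ≤ C₁ * ‖B‖ ∧
        ∃ P ∈ Matrix.unitaryGroup (Fin n) ℂ,
          (∀ i j : Fin n, B i i ≠ B j j →
            (P * QPCocycle.toComplexMat B' * star P) i j = 0) ∧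
          ∀ θ, Commute (W θ * star P) B ∧
            Commute (W θ * star P) (P * QPCocycle.toComplexMat B' * star P) ∧
            Commute (W θ * star P) (P * B'' * star P) := by
  have hn1 : (1 : ℝ) ≤ n := by exact_mod_cast hn
  -- The three terms come from the large modes, the Sylvester bound, and the commutator (`2 + 2`).
  obtain ⟨c, hc⟩ : ∃ c : ℝ, c = d + (9 ^ n) ^ 2 * n ^ 2 + 4 := ⟨_, rfl⟩
  have hc1 : 1 ≤ c := by
    have : 0 ≤ (d : ℝ) + (9 ^ n) ^ 2 * n ^ 2 := by positivity
    linarith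
  have hK0 : 0 ≤ 2 * n * c := by positivity
  -- The term `n` serves the bound of `B'`; the last term is the numerator in `hsmall`, and the rest
  -- makes that inequality strict and `C ≥ 1`.
  obtain ⟨C, hC⟩ : ∃ C : ℝ, C = 1 + n + n ^ 2 * (2 * n * c) * (1 + (2 * n) ^ n) := ⟨_, rfl⟩
  have hC0 : 0 ≤ (n : ℝ) ^ 2 * (2 * n * c) * (1 + (2 * n) ^ n) := by positivity
  have hC1 : 1 ≤ C := by linarith
  have hCpos : 0 < C := by linarith
  refine ⟨C, hCpos, ?_⟩
  intro ω κ τ _ N ρ hρ U hU hUc hUu hUi B hB G hG hGc hN hGn hρs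
  have hUc1 : ContDiff ℝ 1 U := hUc.of_le (by exact_mod_cast Nat.le_add_left 1 d)
  have hUU : ∀ θ, U θ * conjMat (U θ) = 1 := fun θ => by
    rw [← hUi θ]
    exact Matrix.mul_nonsing_inv _ ((Matrix.isUnit_iff_isUnit_det _).mp (hUu θ))
  have hGp : IsTorusFun G := fun θ k => by
    rw [hG, hG, hU θ k, isTorusFun_dirDeriv hU ω θ k]
  set u := cNorm 0 U with hu
  set u₁ := cNorm (d + 1) U with hu₁
  set g := cNorm (d + 1) G with hg
  have hUn : ∀ θ, ‖U θ‖ ≤ u := norm_le_cNorm 0 hU hUc1.continuous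
  have hUd : ∀ a θ, ‖dirDeriv (Pi.single a (1 : ℝ)) U θ‖ ≤ u₁ :=
    norm_dirDeriv_single_le_cNorm (Nat.le_add_left 1 d) hU hUc1
  have hGb : ∀ θ, ‖G θ‖ ≤ g := norm_le_cNorm (d + 1) hGp hGc.continuous
  have hU1 := one_le_norm_of_mul_conjMat hn (hUU 0)
  have hu1 : 1 ≤ u := hU1.trans (hUn 0)
  have hu1' : 1 ≤ u₁ := hU1.trans (norm_le_cNorm (d + 1) hU hUc1.continuous 0)
  clear_value u u₁ g
  have hu0 : 0 < u := by linarith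
  have hg0 : 0 ≤ g := (norm_nonneg _).trans (hGb 0)
  have hN1 : (1 : ℝ) ≤ N := by
    refine le_trans ?_ hN
    exact one_le_mul_of_one_le_of_one_le (one_le_mul_of_one_le_of_one_le hC1 hu1') hu1
  have hN0 : (0 : ℝ) < N := by linarith
  -- the common bound for the small quantities
  obtain ⟨t, ht⟩ : ∃ t : ℝ, t = C⁻¹ * u⁻¹ := ⟨_, rfl⟩
  have ht0 : 0 < t := by rw [ht]; positivity
  have htu : t * u = C⁻¹ := by rw [ht, mul_assoc, inv_mul_cancel₀ hu0.ne', mul_one]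
  have hρu : ρ * u ≤ t := by
    have h1 : ρ ≤ C⁻¹ * (u⁻¹ * u⁻¹) := by
      refine hρs.trans (mul_le_mul_of_nonneg_left ((min_le_left _ _).trans ?_) (by positivity))
      rw [← mul_inv, one_div]
      refine inv_anti₀ (by positivity) ?_
      calc u * u = u ^ 2 := by ring
        _ ≤ u ^ (n + 1) := pow_le_pow_right₀ hu1 (by omega)
        _ ≤ N ^ d * u ^ (n + 1) := le_mul_of_one_le_left (by positivity) (one_le_pow₀ hN1)
    calc ρ * u ≤ C⁻¹ * (u⁻¹ * u⁻¹) * u := by gcongr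
      _ = t * (u⁻¹ * u) := by rw [ht]; ring
      _ = t := by rw [inv_mul_cancel₀ hu0.ne', mul_one]
  have ht1 : t ≤ 1 := by
    rw [ht]
    exact mul_le_one₀ (inv_le_one_of_one_le₀ hC1) (by positivity) (inv_le_one_of_one_le₀ hu1)
  have hρ1 : ρ ≤ 1 := by
    have : ρ ≤ ρ * u := le_mul_of_one_le_right hρ.le hu1
    linarith
  have hu₁N : u₁ / N ≤ t := by
    rw [div_le_iff₀ hN0, ht, ← mul_inv, inv_mul_eq_div, le_div_iff₀ (by positivity)]
    linarith
  have hgρ : g ≤ ρ ^ (2 * n - 1) * t := by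
    refine hGn.trans ?_
    have h1 : ((N : ℝ) ^ (d - 1))⁻¹ ≤ 1 := inv_le_one_of_one_le₀ (one_le_pow₀ hN1)
    have h2 : (u ^ n)⁻¹ ≤ u⁻¹ := inv_anti₀ hu0 (le_self_pow₀ hu1 (by omega))
    calc C⁻¹ * ρ ^ (2 * n - 1) * ((N : ℝ) ^ (d - 1))⁻¹ * (u ^ n)⁻¹
        ≤ C⁻¹ * ρ ^ (2 * n - 1) * 1 * u⁻¹ := by gcongr
      _ = ρ ^ (2 * n - 1) * t := by rw [ht]; ring
  have hgt : g ≤ t := hgρ.trans (mul_le_of_le_one_left ht0.le (pow_le_one₀ hρ.le hρ1))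
  -- The smallness of `G` exactly offsets the divisions by `ρ` in the Sylvester bound.
  have hgρ' : (ρ⁻¹) ^ (2 * n - 1) * g ≤ t := by
    rw [inv_pow, inv_mul_le_iff₀ (by positivity)]
    exact hgρ
  have hR : 2 * (n : ℝ) ^ 2 * (d * (u₁ ^ 2 / N ^ 2) +
      (9 ^ n * (ρ⁻¹) ^ (2 * n - 1)) ^ 2 * (n ^ 2 * g ^ 2) + (2 * g ^ 2 + 2 * (ρ ^ 2 * u ^ 2))) ≤
      (2 * n * c * t) ^ 2 := by
    have e1 : u₁ ^ 2 / (N : ℝ) ^ 2 ≤ t ^ 2 := by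
      rw [← div_pow]; exact pow_le_pow_left₀ (div_nonneg (by linarith) hN0.le) hu₁N 2
    have e2 : (9 ^ n * (ρ⁻¹) ^ (2 * n - 1)) ^ 2 * ((n : ℝ) ^ 2 * g ^ 2) ≤
        (9 ^ n) ^ 2 * n ^ 2 * t ^ 2 := by
      calc _ = (9 ^ n) ^ 2 * (n : ℝ) ^ 2 * ((ρ⁻¹) ^ (2 * n - 1) * g) ^ 2 := by ring
        _ ≤ _ := by gcongr
    have e3 : g ^ 2 ≤ t ^ 2 := pow_le_pow_left₀ hg0 hgt 2
    have e4 : ρ ^ 2 * u ^ 2 ≤ t ^ 2 := by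
      rw [← mul_pow]; exact pow_le_pow_left₀ (mul_nonneg hρ.le hu0.le) hρu 2
    calc _ ≤ 2 * (n : ℝ) ^ 2 * (d * t ^ 2 + (9 ^ n) ^ 2 * n ^ 2 * t ^ 2 +
          (2 * t ^ 2 + 2 * t ^ 2)) := by gcongr
      _ = 2 * (n : ℝ) ^ 2 * t ^ 2 * c := by rw [hc]; ring
      -- `c` is enlarged to `2 * c ^ 2` only to reach a perfect square.
      _ ≤ 2 * (n : ℝ) ^ 2 * t ^ 2 * (2 * c ^ 2) := by
          gcongr
          nlinarith
      _ = _ := by ring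
  obtain ⟨θ, V, hV1, hV2, hV3⟩ := exists_approximate_intertwiner hB (by exact_mod_cast hN1) hρ hρ1
    hU hUc1 hG hGp hGc.continuous hUn hUd hGb hR
  have hKt : 0 ≤ 2 * n * c * t := by positivity
  have hE : ∀ i j, ‖(U θ - V) i j‖ ≤ 2 * n * c * t := fun i j =>
    le_of_abs_le (abs_le_of_sq_le_sq (hV2 i j) hKt)
  have hY : ∀ i j, ‖conjMat (U θ) i j‖ ≤ u := fun i j => by
    rw [conjMat, Matrix.map_apply, RCLike.norm_conj]
    exact (norm_entry_le_l2_opNorm _ i j).trans (hUn θ)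
  -- As `conjMat (U θ)` is the inverse of `U θ`, the matrix is `(U θ - V) * conjMat (U θ)`.
  have hη : ∀ i j, ‖(1 - V * conjMat (U θ)) i j‖ ≤ n * (2 * n * c * t * u) := by
    rw [← hUU θ, ← sub_mul]
    exact norm_mul_apply_le hE hY
  have hsmall : n * (n * (2 * n * c * t * u)) + n ^ 2 * (2 * n) ^ n * (2 * n * c * t * u) < 1 := by
    have e : n * (n * (2 * n * c * t * u)) + n ^ 2 * (2 * n) ^ n * (2 * n * c * t * u) =
        n ^ 2 * (2 * n * c) * (1 + (2 * n) ^ n) * (t * u) := by ring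
    rw [e, htu, ← div_eq_mul_inv, div_lt_one hCpos]
    linarith
  obtain ⟨σ, m, hσ, hσl, hml, hmN, happ⟩ := exists_involution_and_shift hn hρ.le hB hV1 hη
    (fun i j => le_of_abs_le (abs_le_of_sq_le_sq (hV3 i j) hKt)) hY hsmall
  obtain ⟨W, B', B'', h1, h2, h3, h4, h5, h6, h7, h8⟩ := exists_conjugation hn
    (by exact_mod_cast hN1) hρ.le hB ω hσ hσl hml hmN happ
  refine ⟨W, B', B'', h1, h2, h3, h4, h5, h6, h7.trans ?_, h8⟩
  exact mul_le_mul_of_nonneg_right (by linarith) (norm_nonneg _)
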